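/- **Conventions.** Single indices take the values $-1,0,+1$; for a multi-index $\sigma=\{\sigma_1,\dots,\sigma_n\}$ put $\bar\sigma=\sum_i\sigma_i$ (rank $n=0$ is allowed; $\bar\sigma=0$ then), and $\sigma\tau$ is concatenation. Let $\ell\ge 0$ be an integer, and set $$k^{\mu}_{\ell,s}=-\mu\sqrt{\tfrac{(\ell-\mu s)(\ell+\mu s+1)}{2}},\qquad \xi^-_L=\sqrt{\tfrac{L}{2L+1}},\quad \xi^+_L=\sqrt{\tfrac{L+1}{2L+1}},\quad \xi^0_L=0,$$ $$D^+_L=\frac{d}{dr}-\frac{L}{r},\qquad D^-_L=\frac{d}{dr}+\frac{L+1}{r}$$ (there is no $D^0_L$; terms with the factor $\xi^0=0$ are read as $0$). With rows and columns ordered $-1,0,+1$, let $$\mathcal J_0=\mathrm{diag}(-1,0,1),\quad \mathcal J_-=\begin{pmatrix}0&-\sqrt2&0\\0&0&\sqrt2\\0&0&0\end{pmatrix},\quad \mathcal J_+=\begin{pmatrix}0&0&0\\-\sqrt2&0&0\\0&\sqrt2&0\end{pmatrix},$$ and let $\mathcal J^\sigma_n=\sum_{j=1}^n I\otimes\cdots\otimes\mathcal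 J_\sigma^\dagger\otimes\cdots\otimes I$ ($\mathcal J_\sigma^\dagger$ in slot $j$; $\mathcal J^\sigma_0=0$). The real coefficients $\mathcal Q_\ell(\sigma,\mathrm a)$, where $\sigma,\mathrm a$ are multi-indices of the same rank, are defined by $\mathcal Q_\ell(\{\},\{\})=1$ and, for single indices $\sigma,\mathrm a$, multi-indices $\tau,\mathrm b$ of rank $n$ and $L=\ell+\bar{\mathrm b}$, $$\mathcal Q_\ell(\sigma\tau,\mathrm{ab})=\begin{cases}\dfrac{L\,\delta_{\sigma,0}\mathcal Q_\ell(\tau,\mathrm b)-\mathcal R_\ell(\sigma\tau,\mathrm b)}{\sqrt{L(2L+1)}}&\mathrm a=-1\\[2mm] \dfrac{\sigma\,\mathcal R_\ell(\sigma\tau,\mathrm b)}{\sqrt{L(L+1)}}&\mathrm a=0\\[2mm] \dfrac{(L+1)\delta_{\sigma,0}\mathcal Q_\ell(\tau,\mathrm b)+\mathcal R_\ell(\sigma\tau,\mathrm b)}{\sqrt{(L+1)(2L+1)}}&\mathrm a=+1\end{cases}$$ $$\mathcal R_\ell(\sigma\tau,\mathrm b)=-k^\sigma_{\ell,\bar\tau}\mathcal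 Q_\ell(\tau,\mathrm b)+\frac{\sigma}{\sqrt2}\sum_{\tau'}\mathcal J^\sigma_n(\tau,\tau')\mathcal Q_\ell(\tau',\mathrm b).$$ A regularity multi-index $\mathrm a=\{\mathrm a_1,\dots,\mathrm a_n\}$ is called *admissible* for $\ell$ if for every $j$ with $\ell+\mathrm a_{j+1}+\dots+\mathrm a_n=0$ one has $\mathrm a_j=+1$; for non-admissible $\mathrm a$ the coefficients do not exist and are set to $0$. Square roots of negative numbers are set to $0$; they only ever multiply vanishing coefficients. The spin-weighted harmonics are, with $\ell_0=\max(|m|,|s|)$, $\ell_1=\min(|m|,|s|)$ and Jacobi polynomials $P^{(a,b)}_k$, $$Y^s_{\ell,m}=(-1)^{\max(m,-s)}\sqrt{\tfrac{(2\ell+1)(\ell+\ell_0)!(\ell-\ell_0)!}{2(\ell+\ell_1)!(\ell-\ell_1)!}}\,\sin^{|m+s|}\tfrac\theta2\,\cos^{|m-s|}\tfrac\theta2\,P^{(|m+s|,|m-s|)}_{\ell-\ell_0}(\cos\theta)\,e^{im\phi},$$ and $Y^s_{\ell,m}=0$ if $\ell<\ell_0$. Let $e_r,e_\theta,e_\phi$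 be the orthonormal spherical frame of $\mathbb R^3$, $e_0=e_r$, $e_\pm=\frac1{\sqrt2}(e_\theta\mp i e_\phi)$, $e(\sigma)=e_{\sigma_1}\otimes\cdots\otimes e_{\sigma_n}$. The gradient of a tensor field is $\nabla \mathrm T=e_r\otimes\partial_r \mathrm T+\frac1r e_\theta\otimes\partial_\theta \mathrm T+\frac1{r\sin\theta}e_\phi\otimes\partial_\phi \mathrm T$, where $\partial$ differentiates the full tensor, frame included (that is, its Cartesian components); $\nabla\cdot \mathrm T$ is the contraction of the first two indices of $\nabla \mathrm T$ by the Euclidean (bilinear) dot product, and $\nabla\cdot\nabla \mathrm T$ is the divergence of the gradient. Let $\Omega=\{(r,\theta,\phi):0<r<1,\ 0<\theta<\pi\}$. For functions $A^{\mathrm a}_{\ell,m}:(0,1)\to\mathbb C$ ($|m|\le\ell$, $\mathrm a$ of rank $n$), the series $$\mathrm T=\sum_{\ell,m}\mathrm T_{\ell,m},\qquad \mathrm T_{\ell,m}=\sum_{\mathrm a,\sigma}\mathcal Q_\ell(\sigma,\mathrm a)A^{\mathrm a}_{\ell,m}(r)\,Y^{\bar\sigma}_{\ell,m}(\theta,\phi)\,e(\sigma)\qquad(*)$$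 is called the field with radial coefficients $A^{\mathrm a}_{\ell,m}$. It is said to converge in $C^k$ if it is (unconditionally) summable at every point of $\Omega$, and the series of its termwise derivatives in $(r,\theta,\phi)$ of each order $1,\dots,k$ are summable locally uniformly on $\Omega$ (this is automatic if only finitely many $A^{\mathrm a}_{\ell,m}$ are non-zero). **Theorem.** 1. (Contraction.) For all ranks $n\ge0$, all integers $\ell\ge0$, all single indices $\mathrm a,\mathrm b$ and all multi-indices $\kappa,\mathrm c$ of rank $n$ such that $\mathrm{abc}$ is admissible for $\ell$, $$\sum_{\sigma,\tau}\delta_{\sigma,-\tau}\,\mathcal Q_\ell(\sigma\tau\kappa,\mathrm{abc})=\delta_{\mathrm a,-\mathrm b}\sqrt{\frac{2(\ell+\mathrm b+\bar{\mathrm c})+1}{2(\ell+\bar{\mathrm c})+1}}\;\mathcal Q_\ell(\kappa,\mathrm c),$$ $$\sum_{\sigma,\tau}\delta_{\sigma,-\tau}\,\xi^{\mathrm a}_{\ell+\mathrm b+\bar{\mathrm c}}\,\mathcal Q_\ell(\sigma\tau\kappa,\mathrm{abc})=\delta_{\mathrm a,-\mathrm b}\,\xi^{\mathrm b}_{\ell+\bar{\mathrm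 c}}\,\mathcal Q_\ell(\kappa,\mathrm c).$$ 2. (Divergence.) For every $n\ge0$: if $\mathrm T$ is the rank-$(n+1)$ field with radial coefficients $A^{\mathrm{ab}}_{\ell,m}$ ($\mathrm a$ a single index, $\mathrm b$ of rank $n$), all differentiable on $(0,1)$, and the series $(*)$ converges in $C^1$, then $\mathrm T$ is differentiable on $\Omega$ and $\nabla\cdot \mathrm T$ is, on $\Omega$, the (pointwise summable) rank-$n$ field with radial coefficients $$B^{\mathrm b}_{\ell,m}(r)=\sum_{\mathrm a}\xi^{\mathrm a}_{\ell+\bar{\mathrm b}}\,D^{-\mathrm a}_{\ell+\mathrm a+\bar{\mathrm b}}\,A^{\mathrm{ab}}_{\ell,m}(r).$$ 3. (Laplacian.) For every $n\ge0$: if $\mathrm T$ is the rank-$n$ field with radial coefficients $A^{\mathrm a}_{\ell,m}$, all twice differentiable on $(0,1)$, and the series $(*)$ converges in $C^2$, then $\mathrm T$ is twice differentiable on $\Omega$ and $\nabla\cdot\nabla \mathrm T$ is, on $\Omega$, the (pointwise summable) rank-$n$ field with radial coefficients $$B^{\mathrm a}_{\ell,m}(r)=D^-_{\ell+\bar{\mathrm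 a}+1}D^+_{\ell+\bar{\mathrm a}}A^{\mathrm a}_{\ell,m}(r)=D^+_{\ell+\bar{\mathrm a}-1}D^-_{\ell+\bar{\mathrm a}}A^{\mathrm a}_{\ell,m}(r).$$ -/

import Mathlib

open scoped BigOperators

noncomputable section

namespace BallTensor

/-! ## Multi-indices

Every single index (a spin index `σ` or a regularity index `a`) takes the values `-1, 0, +1`;
it is an element of `SignType`.  Indices of rank-`n` objects are functions `Fin n → SignType`.
If `σ` is a single index and `τ` a multi-index, the multi-index `στ` is `Fin.cons σ τ`. -/

/-- Multi-indices of rank `n`, with entries in `{-1, 0, +1}`. -/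
abbrev MIdx (n : ℕ) : Type := Fin n → SignType

/-- The sum of the entries of a multi-index (written with an overbar). -/
def wt {n : ℕ} (σ : MIdx n) : ℤ := ∑ i, (σ i : ℤ)

/-- The index set of the spherical harmonic modes: pairs `(ℓ, m)` with `|m| ≤ ℓ`. -/
abbrev Mode : Type := {q : ℕ × ℤ // |q.2| ≤ (q.1 : ℤ)}

/-! ## The orthogonal transformations `Q_ℓ` -/

/-- The wavenumbers `k^μ_{ℓ,s} = -μ √((ℓ - μ s)(ℓ + μ s + 1) / 2)`. -/
def kNum (ℓ : ℕ) (s : ℤ) (μ : SignType) : ℝ :=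
  -(μ : ℝ) * √(((ℓ : ℝ) - μ * s) * ((ℓ : ℝ) + μ * s + 1) / 2)

/-- `ξ^-_L = √(L/(2L+1))`, `ξ^+_L = √((L+1)/(2L+1))`, `ξ^0_L = 0`. -/
def xi (a : SignType) (L : ℤ) : ℝ :=
  match a with
  | .neg => √((L : ℝ) / (2 * L + 1))
  | .zero => 0
  | .pos => √(((L : ℝ) + 1) / (2 * L + 1))

/-- The entries of the `3 × 3` matrices `J_-`, `J_0`, `J_+`, rows and columns indexed by
`-1, 0, +1`: `genJ μ` is the matrix `J_μ`. -/
def genJ : SignType → SignType → SignType → ℝ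
  | .neg, .neg, .zero => -√2
  | .neg, .zero, .pos => √2
  | .zero, .neg, .neg => -1
  | .zero, .pos, .pos => 1
  | .pos, .zero, .neg => -√2
  | .pos, .pos, .zero => √2
  | _, _, _ => 0

/-- The entries of the rank-`n` Kronecker sum `J† ⊕ ⋯ ⊕ J†` (`n` summands) of the (real) matrix
`J_σ†`, that is of `∑ j, I ⊗ ⋯ ⊗ J_σ† ⊗ ⋯ ⊗ I` with `J_σ†` in the `j`-th slot.
It is `0` in rank `0`. -/
def kronJ {n : ℕ} (σ : SignType) (τ τ' : MIdx n) : ℝ :=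
  ∑ j, if ∀ i, i ≠ j → τ i = τ' i then genJ σ (τ' j) (τ j) else 0

/-- The coefficients `R_ℓ(στ, b)`, computed from the rank-`n` transformation `M = Q_ℓ`. -/
def rCoef (ℓ : ℕ) {n : ℕ} (M : MIdx n → MIdx n → ℝ) (σ : SignType) (τ b : MIdx n) : ℝ :=
  -kNum ℓ (wt τ) σ * M τ b + (σ : ℝ) / √2 * ∑ τ', kronJ σ τ τ' * M τ' b

/-- The transformations `Q_ℓ(σ, a)` of rank `n`, by recursion on the rank, the new index being
the first one.  With `L = ℓ + b̄`, the entries that do not exist (`L = 0` and `a ≠ +1` at some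
stage) come out as `0`, because `x / 0 = 0`. -/
def qMat (ℓ : ℕ) : (n : ℕ) → MIdx n → MIdx n → ℝ
  | 0, _, _ => 1
  | n + 1, σ, a =>
    let τ : MIdx n := Fin.tail σ
    let b : MIdx n := Fin.tail a
    let L : ℝ := (ℓ : ℝ) + wt b
    let d : ℝ := if σ 0 = 0 then 1 else 0
    let R : ℝ := rCoef ℓ (qMat ℓ n) (σ 0) τ b
    match a 0 with
    | .neg => (L * d * qMat ℓ n τ b - R) / √(L * (2 * L + 1))
    | .zero => (σ 0 : ℝ) * R / √(L * (L + 1))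
    | .pos => ((L + 1) * d * qMat ℓ n τ b + R) / √((L + 1) * (2 * L + 1))

/-- The regularity multi-index `a` exists for the degree `ℓ`: adding its entries to `ℓ` one after
the other, starting from the last, only the entry `+1` is ever added to the degree `0`. -/
def Admissible (ℓ : ℕ) : {n : ℕ} → MIdx n → Prop
  | 0, _ => True
  | _ + 1, a => Admissible ℓ (Fin.tail a) ∧ ((ℓ : ℤ) + wt (Fin.tail a) = 0 → a 0 = 1)

/-! ## Spin-weighted spherical harmonics -/

/-- The Jacobi polynomial `P_k^{(a,b)}` with integer parameters `a, b ≥ 0`, evaluated at `z`. -/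
def jacobiP (k a b : ℕ) (z : ℝ) : ℝ :=
  ∑ j ∈ Finset.range (k + 1), ((k + a).choose (k - j) : ℝ) * ((k + b).choose j : ℝ)
    * ((z - 1) / 2) ^ j * ((z + 1) / 2) ^ (k - j)

/-- The spin-weighted spherical harmonic `Y^s_{ℓ,m}(θ, φ)`; it is `0` if `ℓ < max(|m|, |s|)`. -/
def sphY (ℓ : ℕ) (m s : ℤ) (θ φ : ℝ) : ℂ :=
  let l0 : ℕ := max m.natAbs s.natAbs
  let l1 : ℕ := min m.natAbs s.natAbs
  if ℓ < l0 then 0 else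
    (((-1 : ℝ) ^ (max m (-s))
      * √((2 * (ℓ : ℝ) + 1) * ((ℓ + l0).factorial : ℝ) * ((ℓ - l0).factorial : ℝ)
          / (2 * ((ℓ + l1).factorial : ℝ) * ((ℓ - l1).factorial : ℝ)))
      * Real.sin (θ / 2) ^ (m + s).natAbs * Real.cos (θ / 2) ^ (m - s).natAbs
      * jacobiP (ℓ - l0) (m + s).natAbs (m - s).natAbs (Real.cos θ) : ℝ) : ℂ)
    * Complex.exp (Complex.I * m * φ)

/-! ## Tensor fields on the ball in spherical coordinates

A rank-`n` tensor is given by its `3 ^ n` complex components in the fixed Cartesian frame, and a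
tensor field is a tensor-valued function of the spherical coordinates `p = (r, θ, φ)`. -/

/-- Cartesian components of complex tensors of rank `n` on three-dimensional Euclidean space. -/
abbrev Tensor (n : ℕ) : Type := (Fin n → Fin 3) → ℂ

/-- The domain of the spherical coordinates `(r, θ, φ)` of the unit ball. -/
def chart : Set (ℝ × ℝ × ℝ) :=
  {p | 0 < p.1 ∧ p.1 < 1 ∧ 0 < p.2.1 ∧ p.2.1 < Real.pi}

/-- The radial unit vector. -/
def eR (p : ℝ × ℝ × ℝ) : Fin 3 → ℂ :=
  ![(Real.sin p.2.1 * Real.cos p.2.2 : ℝ), (Real.sin p.2.1 * Real.sin p.2.2 : ℝ),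
    (Real.cos p.2.1 : ℝ)]

/-- The unit vector in the direction of increasing colatitude `θ`. -/
def eTheta (p : ℝ × ℝ × ℝ) : Fin 3 → ℂ :=
  ![(Real.cos p.2.1 * Real.cos p.2.2 : ℝ), (Real.cos p.2.1 * Real.sin p.2.2 : ℝ),
    (-Real.sin p.2.1 : ℝ)]

/-- The unit vector in the direction of increasing longitude `φ`. -/
def ePhi (p : ℝ × ℝ × ℝ) : Fin 3 → ℂ :=
  ![(-Real.sin p.2.2 : ℝ), (Real.cos p.2.2 : ℝ), 0]

/-- The spin basis `e_± = (e_θ ∓ i e_φ)/√2`, `e_0 = e_r`. -/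
def spinE (σ : SignType) (p : ℝ × ℝ × ℝ) : Fin 3 → ℂ :=
  match σ with
  | .neg => ((√2 : ℝ) : ℂ)⁻¹ • (eTheta p + Complex.I • ePhi p)
  | .zero => eR p
  | .pos => ((√2 : ℝ) : ℂ)⁻¹ • (eTheta p - Complex.I • ePhi p)

/-- The tensor basis element `e(σ) = e_{σ₁} ⊗ ⋯ ⊗ e_{σₙ}`. -/
def tensE {n : ℕ} (σ : MIdx n) (p : ℝ × ℝ × ℝ) : Tensor n :=
  fun K => ∏ i, spinE (σ i) p (K i)

/-- The gradient `∇T = e_r ⊗ ∂_r T + e_θ ⊗ r⁻¹ ∂_θ T + e_φ ⊗ (r sin θ)⁻¹ ∂_φ T`.  The direction of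
differentiation is the first index. -/
def tgrad {n : ℕ} (T : ℝ × ℝ × ℝ → Tensor n) : ℝ × ℝ × ℝ → Tensor (n + 1) :=
  fun p K =>
    eR p (K 0) * fderiv ℝ T p (1, 0, 0) (Fin.tail K)
    + eTheta p (K 0) * ((p.1 : ℂ)⁻¹ * fderiv ℝ T p (0, 1, 0) (Fin.tail K))
    + ePhi p (K 0) * (((p.1 * Real.sin p.2.1 : ℝ) : ℂ)⁻¹ * fderiv ℝ T p (0, 0, 1) (Fin.tail K))

/-- Contraction of the first two indices by the Euclidean dot product. -/
def contract {n : ℕ} (S : Tensor (n + 2)) : Tensor n :=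
  fun K => ∑ i, S (Fin.cons i (Fin.cons i K : Fin (n + 1) → Fin 3))

/-- The divergence `∇ · T`. -/
def tdiv {n : ℕ} (T : ℝ × ℝ × ℝ → Tensor (n + 1)) : ℝ × ℝ × ℝ → Tensor n :=
  fun p => contract (tgrad T p)

/-- The Laplacian `∇ · ∇ T`. -/
def tlap {n : ℕ} (T : ℝ × ℝ × ℝ → Tensor n) : ℝ × ℝ × ℝ → Tensor n :=
  tdiv (tgrad T)

/-- The field with radial coefficients `A^a(r)` in the single mode `(ℓ, m)`:
`∑_{a, σ} Q_ℓ(σ, a) A^a(r) Y^{σ̄}_{ℓ,m}(θ, φ) e(σ)`. -/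
def modeField {n : ℕ} (q : Mode) (A : MIdx n → ℝ → ℂ) : ℝ × ℝ × ℝ → Tensor n :=
  fun p => ∑ a : MIdx n, ∑ σ : MIdx n,
    ((qMat q.1.1 n σ a : ℂ) * A a p.1 * sphY q.1.1 q.1.2 (wt σ) p.2.1 p.2.2) • tensE σ p

/-- The radial operators `D^+_L = d/dr - L/r` and `D^-_L = d/dr + (L+1)/r`.  There is no operator
`D^0_L` (it would only occur with the factor `ξ^0 = 0`); the value chosen for it is `0`. -/
def radD (a : SignType) (L : ℤ) (f : ℝ → ℂ) : ℝ → ℂ :=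
  match a with
  | .neg => fun r => deriv f r + ((L : ℂ) + 1) / (r : ℂ) * f r
  | .zero => fun _ => 0
  | .pos => fun r => deriv f r - (L : ℂ) / (r : ℂ) * f r

end BallTensor

end

/-! ### Ladder operators on arrays of spin components, and the columns of Q as their eigenvectors.
-/

open scoped BigOperators
noncomputable section

namespace BallTensor

/-! The angular part of the gradient acts on arrays of spin components through two ladder operators
R_+ and R_- (`rOp`), which combine the wavenumbers with the generators acting on the tensor slots.
They satisfy an angular momentum commutation relation (`rOp_commutator`) and are minus each other's
adjoints (`sum_rOp_mul`). The recursion for Q diagonalises R_+R_-: if v is a column of degree L,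
that is R_+R_- v = -L(L+1)/2 v, then on the arrays with slices (y R_-v, x v, z R_+v) the
eigenvectors have degrees L-1, L, L+1, and they are the three columns obtained by prefixing an index
(`IsEigen.succ`, `isEigen_qCol`). Contracting two prefixed indices applies two opposite ladder
operators, or none, and so returns a multiple of v; evaluating the multiple gives the contraction
formulas (`coef_contract`, `contraction_xi`).

For fields, the harmonics are matrix elements of half-angle rotations of binary forms (`wigC`,
`sphY_eq`). Differentiating the rotation, and conjugating the weight operator by it, yields the spin
raising and lowering relations (`sphY_eth`). Combined with the derivatives of the frame, they show
that the gradient of a single mode has radial component d/dr and angular components -R_±/r. The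
algebraic identity `sum_qMat_mul_xi` rewrites this as a mode field with coefficients ξ^a D^a A^b
(`tgrad_modeField`). Contraction gives the divergence of a mode. The Laplacian is the divergence of
the gradient: both products of radial operators equal f'' + 2f'/r - L(L+1)f/r², and they are
weighted by squares of ξ whose sum is 1. Locally uniform convergence of the derivative series
transfers the single-mode formulas to the series. -/

theorem sum_signType {M : Type*} [AddCommMonoid M] (f : SignType → M) :
    ∑ σ, f σ = f (-1) + f 0 + f 1 := by
  have : (Finset.univ : Finset SignType) = {-1, 0, 1} := by decide
  rw [this, Finset.sum_insert (by decide), Finset.sum_insert (by decide), Finset.sum_singleton,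
    add_assoc]

theorem forall_signType {p : SignType → Prop} : (∀ σ, p σ) ↔ p (-1) ∧ p 0 ∧ p 1 := by
  constructor
  · exact fun h => ⟨h _, h _, h _⟩
  · rintro ⟨h1, h2, h3⟩ σ
    cases σ <;> assumption

theorem sum_mIdx_succ {M : Type*} [AddCommMonoid M] {n : ℕ} (f : MIdx (n + 1) → M) :
    ∑ σ, f σ = ∑ σ : SignType, ∑ τ : MIdx n, f (Fin.cons σ τ) := by
  rw [← Fintype.sum_prod_type', ← (Fin.consEquiv fun _ : Fin (n + 1) => SignType).sum_comp]
  rfl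

@[simp] theorem wt_cons {n : ℕ} (σ : SignType) (τ : MIdx n) :
    wt (Fin.cons σ τ : MIdx (n + 1)) = (σ : ℤ) + wt τ := by
  simp [wt, Fin.sum_univ_succ]

theorem kronJ_cons {n : ℕ} (σ ρ ρ' : SignType) (τ τ' : MIdx n) :
    kronJ σ (Fin.cons ρ τ : MIdx (n + 1)) (Fin.cons ρ' τ')
      = (if τ = τ' then genJ σ ρ' ρ else 0) + if ρ = ρ' then kronJ σ τ τ' else 0 := by
  unfold kronJ
  rw [Fin.sum_univ_succ]
  congr 1
  · simp only [Fin.forall_fin_succ, Fin.cons_zero, Fin.cons_succ, ne_eq, not_true_eq_false,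
      false_implies, true_and, Fin.succ_ne_zero, not_false_eq_true, true_implies, funext_iff]
  · by_cases h : ρ = ρ'
    · simp [Fin.forall_fin_succ, h, Fin.succ_inj]
    · simp [Fin.forall_fin_succ, h, (Fin.succ_ne_zero _).symm]

/-- The action of a gradient component on arrays of charge `t`, that is on arrays whose entry at
`τ` multiplies the harmonic of spin `wt τ + t`. -/
def rOp (ℓ : ℕ) {n : ℕ} (σ : SignType) (t : ℤ) (v : MIdx n → ℝ) (τ : MIdx n) : ℝ :=
  -kNum ℓ (wt τ + t) σ * v τ + (σ : ℝ) / √2 * ∑ τ', kronJ σ τ τ' * v τ'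

theorem rCoef_eq_rOp (ℓ : ℕ) {n : ℕ} (M : MIdx n → MIdx n → ℝ) (σ : SignType) (τ b : MIdx n) :
    rCoef ℓ M σ τ b = rOp ℓ σ 0 (fun τ => M τ b) τ := by
  simp [rCoef, rOp]

/-- The slice of an array at a value of the first index. -/
def slice {n : ℕ} (w : MIdx (n + 1) → ℝ) (ρ : SignType) : MIdx n → ℝ := fun τ => w (Fin.cons ρ τ)

section
variable (ℓ : ℕ) {n : ℕ}

/-- The Kronecker sum splits into the first slot and the remaining ones. The slice at `ρ` has its
charge shifted by `ρ`; allowing an arbitrary charge `t` is what makes induction on the rank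
possible. -/
theorem rOp_cons (σ : SignType) (t : ℤ) (w : MIdx (n + 1) → ℝ) (ρ : SignType) (τ : MIdx n) :
    rOp ℓ σ t w (Fin.cons ρ τ) = rOp ℓ σ (t + ρ) (slice w ρ) τ
      + (σ : ℝ) / √2 * ∑ ρ', genJ σ ρ' ρ * slice w ρ' τ := by
  simp only [rOp, slice, sum_mIdx_succ, kronJ_cons, wt_cons, add_mul, ite_mul, zero_mul,
    Finset.sum_add_distrib, Finset.sum_ite_eq, Finset.mem_univ, if_true]
  have h : ∑ x, ∑ y, (if ρ = x then kronJ σ τ y * w (Fin.cons x y) else 0)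
      = ∑ y, kronJ σ τ y * w (Fin.cons ρ y) := by
    rw [Finset.sum_comm]
    simp
  rw [h, show (ρ : ℤ) + wt τ + t = wt τ + (t + ρ) by ring]
  ring

theorem rOp_add (σ : SignType) (t : ℤ) (v w : MIdx n → ℝ) :
    rOp ℓ σ t (v + w) = rOp ℓ σ t v + rOp ℓ σ t w := by
  ext τ
  simp only [rOp, Pi.add_apply, mul_add, Finset.sum_add_distrib]
  ring

theorem rOp_smul (σ : SignType) (t : ℤ) (c : ℝ) (v : MIdx n → ℝ) :
    rOp ℓ σ t (c • v) = c • rOp ℓ σ t v := by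
  ext τ
  simp only [rOp, Pi.smul_apply, smul_eq_mul, mul_left_comm _ c, ← Finset.mul_sum]
  ring

theorem rOp_sub (σ : SignType) (t : ℤ) (v w : MIdx n → ℝ) :
    rOp ℓ σ t (v - w) = rOp ℓ σ t v - rOp ℓ σ t w := by
  rw [sub_eq_add_neg, sub_eq_add_neg, ← neg_one_smul ℝ w, rOp_add, rOp_smul, neg_one_smul]

theorem rOp_zero_left (t : ℤ) (v : MIdx n → ℝ) : rOp ℓ 0 t v = 0 := by
  ext τ
  simp [rOp, kNum]


theorem slice_rOp_pos_neg (t : ℤ) (w : MIdx (n + 1) → ℝ) :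
    slice (rOp ℓ 1 t w) (-1) = rOp ℓ 1 (t - 1) (slice w (-1)) - slice w 0 := by
  ext τ
  simp only [slice, rOp_cons, sum_signType]
  simp [genJ, ← sub_eq_add_neg]
  rfl

theorem slice_rOp_pos_zero (t : ℤ) (w : MIdx (n + 1) → ℝ) :
    slice (rOp ℓ 1 t w) 0 = rOp ℓ 1 t (slice w 0) + slice w 1 := by
  ext τ
  simp only [slice, rOp_cons, sum_signType]
  simp [genJ]
  rfl

theorem slice_rOp_pos_pos (t : ℤ) (w : MIdx (n + 1) → ℝ) :
    slice (rOp ℓ 1 t w) 1 = rOp ℓ 1 (t + 1) (slice w 1) := by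
  ext τ
  simp only [slice, rOp_cons, sum_signType]
  simp [genJ]

theorem slice_rOp_neg_neg (t : ℤ) (w : MIdx (n + 1) → ℝ) :
    slice (rOp ℓ (-1) t w) (-1) = rOp ℓ (-1) (t - 1) (slice w (-1)) := by
  ext τ
  simp only [slice, rOp_cons, sum_signType]
  simp [genJ, ← sub_eq_add_neg]

theorem slice_rOp_neg_zero (t : ℤ) (w : MIdx (n + 1) → ℝ) :
    slice (rOp ℓ (-1) t w) 0 = rOp ℓ (-1) t (slice w 0) + slice w (-1) := by
  ext τ
  simp only [slice, rOp_cons, sum_signType]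
  simp [genJ]
  simp only [slice]
  field_simp

theorem slice_rOp_neg_pos (t : ℤ) (w : MIdx (n + 1) → ℝ) :
    slice (rOp ℓ (-1) t w) 1 = rOp ℓ (-1) (t + 1) (slice w 1) - slice w 0 := by
  ext τ
  simp only [slice, rOp_cons, sum_signType]
  simp [genJ]
  simp only [slice]
  field_simp
  ring

@[simp] theorem slice_sub (v w : MIdx (n + 1) → ℝ) (ρ : SignType) :
    slice (v - w) ρ = slice v ρ - slice w ρ := rfl

@[simp] theorem slice_smul (c : ℝ) (v : MIdx (n + 1) → ℝ) (ρ : SignType) :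
    slice (c • v) ρ = c • slice v ρ := rfl

theorem ext_slice {v w : MIdx (n + 1) → ℝ} (h1 : slice v (-1) = slice w (-1))
    (h2 : slice v 0 = slice w 0) (h3 : slice v 1 = slice w 1) : v = w := by
  ext σ
  rw [← Fin.cons_self_tail σ]
  have : ∀ ρ, slice v ρ = slice w ρ := forall_signType.2 ⟨h1, h2, h3⟩
  exact congrFun (this (σ 0)) (Fin.tail σ)

/-- Both wavenumbers have the same radicand, and the bound on `s` makes it nonnegative, so the
product of the roots is the radicand. -/
theorem kNum_pos_mul_neg {s : ℤ} (h : |s| ≤ ℓ) :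
    kNum ℓ (s - 1) 1 * kNum ℓ s (-1) = -(((ℓ : ℝ) + s) * (ℓ - s + 1) / 2) := by
  have h1 : (-(ℓ : ℝ)) ≤ s := by exact_mod_cast (abs_le.1 h).1
  have h2 : (s : ℝ) ≤ ℓ := by exact_mod_cast (abs_le.1 h).2
  have h3 : (0 : ℝ) ≤ ((ℓ : ℝ) + s) * (ℓ - s + 1) / 2 :=
    div_nonneg (mul_nonneg (by linarith) (by linarith)) zero_le_two
  simp only [kNum, SignType.coe_one, SignType.coe_neg]
  push_cast
  rw [show ((ℓ : ℝ) - 1 * ((s : ℝ) - 1)) * (ℓ + 1 * ((s : ℝ) - 1) + 1) / 2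
      = ((ℓ : ℝ) + s) * (ℓ - s + 1) / 2 by ring,
    show ((ℓ : ℝ) - -1 * (s : ℝ)) * (ℓ + -1 * (s : ℝ) + 1) / 2
      = ((ℓ : ℝ) + s) * (ℓ - s + 1) / 2 by ring]
  linarith [Real.mul_self_sqrt h3]

theorem kNum_neg_mul_pos {s : ℤ} (h : |s| ≤ ℓ) :
    kNum ℓ (s + 1) (-1) * kNum ℓ s 1 = -(((ℓ : ℝ) - s) * (ℓ + s + 1) / 2) := by
  have h1 : (-(ℓ : ℝ)) ≤ s := by exact_mod_cast (abs_le.1 h).1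
  have h2 : (s : ℝ) ≤ ℓ := by exact_mod_cast (abs_le.1 h).2
  have h3 : (0 : ℝ) ≤ ((ℓ : ℝ) - s) * (ℓ + s + 1) / 2 :=
    div_nonneg (mul_nonneg (by linarith) (by linarith)) zero_le_two
  simp only [kNum, SignType.coe_one, SignType.coe_neg]
  push_cast
  rw [show ((ℓ : ℝ) - -1 * ((s : ℝ) + 1)) * (ℓ + -1 * ((s : ℝ) + 1) + 1) / 2
      = ((ℓ : ℝ) - s) * (ℓ + s + 1) / 2 by ring,
    show ((ℓ : ℝ) - 1 * (s : ℝ)) * (ℓ + 1 * (s : ℝ) + 1) / 2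
      = ((ℓ : ℝ) - s) * (ℓ + s + 1) / 2 by ring]
  linarith [Real.mul_self_sqrt h3]

theorem kNum_neg_succ (s : ℤ) : kNum ℓ (s + 1) (-1) = -kNum ℓ s 1 := by
  simp only [kNum, SignType.coe_one, SignType.coe_neg]
  push_cast
  rw [show ((ℓ : ℝ) - -1 * ((s : ℝ) + 1)) * (ℓ + -1 * ((s : ℝ) + 1) + 1) / 2
      = ((ℓ : ℝ) - 1 * s) * (ℓ + 1 * s + 1) / 2 by ring]
  ring

theorem kNum_eq_zero {s : ℤ} {σ : SignType} (h : |s| ≤ ℓ) (h' : (ℓ : ℤ) < |s + σ|) :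
    kNum ℓ s σ = 0 := by
  cases σ
  · simp [kNum]
  · have : s = -ℓ := by
      simp only [SignType.neg_eq_neg_one, SignType.coe_neg, SignType.coe_one] at h'
      rw [abs_le] at h
      rw [lt_abs] at h'
      omega
    subst this
    simp [kNum]
  · have : s = ℓ := by
      simp only [SignType.pos_eq_one, SignType.coe_one] at h'
      rw [abs_le] at h
      rw [lt_abs] at h'
      omega
    subst this
    simp [kNum]

/-- An array of charge `t` only involves harmonics of spin at most `ℓ`. -/
def Supp (t : ℤ) (v : MIdx n → ℝ) : Prop := ∀ τ, (ℓ : ℤ) < |wt τ + t| → v τ = 0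

variable {ℓ}

theorem Supp.slice {t : ℤ} {w : MIdx (n + 1) → ℝ} (h : Supp ℓ t w) (ρ : SignType) :
    Supp ℓ (t + ρ) (slice w ρ) := fun τ hτ => h _ (by
  rw [wt_cons]
  convert hτ using 2
  ring)

theorem genJ_ne_zero {σ a b : SignType} (h : genJ σ a b ≠ 0) : (a : ℤ) = b + σ := by
  cases σ <;> cases a <;> cases b <;> simp [genJ] at h ⊢

/-- Selection rule: only one slot changes, and there the generator shifts the index by `σ`. Both
terms of `rOp` therefore multiply harmonics of the same spin. -/
theorem kronJ_ne_zero {σ : SignType} {τ τ' : MIdx n} (h : kronJ σ τ τ' ≠ 0) :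
    wt τ' = wt τ + σ := by
  obtain ⟨j, -, hj⟩ := Finset.exists_ne_zero_of_sum_ne_zero h
  have h1 : ∀ i, i ≠ j → τ i = τ' i := by
    by_contra h1
    simp [h1] at hj
  rw [if_pos h1] at hj
  have h2 := genJ_ne_zero hj
  unfold wt
  rw [← Finset.add_sum_erase _ _ (Finset.mem_univ j),
    ← Finset.add_sum_erase _ (fun i => (τ i : ℤ)) (Finset.mem_univ j), h2,
    Finset.sum_congr rfl fun i hi => by rw [← h1 i (Finset.ne_of_mem_erase hi)]]
  ring

/-- The wavenumber vanishes at the end of the ladder, and the Kronecker sum only reads entries of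
the same total spin. -/
theorem Supp.rOp {t : ℤ} {v : MIdx n → ℝ} (h : Supp ℓ t v) (σ : SignType) :
    Supp ℓ (t + σ) (rOp ℓ σ t v) := by
  intro τ hτ
  have h1 : kNum ℓ (wt τ + t) σ * v τ = 0 := by
    by_cases hs : |wt τ + t| ≤ ℓ
    · rw [kNum_eq_zero ℓ hs (by rwa [add_assoc]), zero_mul]
    · rw [h τ (not_le.1 hs), mul_zero]
  have h2 : ∀ τ', kronJ σ τ τ' * v τ' = 0 := by
    intro τ'
    by_cases hk : kronJ σ τ τ' = 0
    · rw [hk, zero_mul]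
    · rw [h τ', mul_zero]
      rw [kronJ_ne_zero hk]
      convert hτ using 2
      ring
  simp only [BallTensor.rOp, h2, neg_mul, h1]
  simp

/-- In rank 0 this is a difference of two products of wavenumbers; the support condition is needed
because those products are wrong once a square root of a negative number is replaced by 0. In higher
rank the cross terms between slices cancel, except that the outer slices, of charge `t ∓ 1`, receive
a multiple of themselves which corrects the charge to `t`. -/
theorem rOp_commutator : ∀ {n : ℕ} {t : ℤ} {v : MIdx n → ℝ}, Supp ℓ t v →
    rOp ℓ 1 (t - 1) (rOp ℓ (-1) t v) - rOp ℓ (-1) (t + 1) (rOp ℓ 1 t v) = -(t : ℝ) • v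
  | 0, t, v, h => by
    ext τ
    by_cases hs : |t| ≤ ℓ
    · have h1 := kNum_pos_mul_neg ℓ hs
      have h2 := kNum_neg_mul_pos ℓ hs
      simp only [rOp, wt, kronJ, Pi.sub_apply, Pi.smul_apply, Finset.univ_eq_empty,
        Finset.sum_empty, zero_mul, Finset.sum_const_zero, mul_zero, add_zero, zero_add, smul_eq_mul]
      linear_combination (v τ) * h1 - (v τ) * h2
    · have h0 : v = 0 := by
        ext τ
        exact h τ (by simpa [wt] using hs)
      subst h0
      simp [rOp]
  | n + 1, t, w, h => by
    have ha := rOp_commutator (h.slice (-1))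
    have hb := rOp_commutator (h.slice 0)
    have hc := rOp_commutator (h.slice 1)
    simp only [SignType.coe_neg, SignType.coe_one, SignType.coe_zero, add_zero, ← sub_eq_add_neg]
      at ha hb hc
    apply ext_slice
    · simp only [slice_sub, slice_smul, slice_rOp_pos_neg, slice_rOp_neg_neg, slice_rOp_neg_zero,
        rOp_sub, add_sub_cancel_right]
      rw [sub_add_cancel] at ha
      push_cast at ha
      linear_combination (norm := module) ha
    · simp only [slice_sub, slice_smul, slice_rOp_pos_zero, slice_rOp_neg_zero, slice_rOp_neg_pos,
        slice_rOp_pos_neg, rOp_add]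
      linear_combination (norm := module) hb
    · simp only [slice_sub, slice_smul, slice_rOp_pos_pos, slice_rOp_neg_pos, slice_rOp_pos_zero,
        rOp_sub, sub_add_cancel]
      rw [add_sub_cancel_right] at hc
      push_cast at hc
      linear_combination (norm := module) hc

theorem genJ_swap (a b : SignType) : genJ 1 a b = genJ (-1) b a := by
  cases a <;> cases b <;> rfl

theorem kronJ_swap (τ τ' : MIdx n) : kronJ 1 τ τ' = kronJ (-1) τ' τ := by
  unfold kronJ
  refine Finset.sum_congr rfl fun j _ => ?_
  simp only [eq_comm (a := τ _), genJ_swap]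

/-- Integration by parts for the ladder operators: the two generators are transposes of each other,
and `kNum_neg_succ` matches the wavenumbers with opposite sign. -/
theorem sum_rOp_mul (t : ℤ) (v w : MIdx n → ℝ) :
    ∑ τ, rOp ℓ 1 t v τ * w τ = -∑ τ, v τ * rOp ℓ (-1) (t + 1) w τ := by
  have h : ∑ τ, (∑ τ', kronJ 1 τ τ' * v τ') * w τ = ∑ τ, v τ * ∑ τ', kronJ (-1) τ τ' * w τ' := by
    simp only [Finset.sum_mul, Finset.mul_sum]
    rw [Finset.sum_comm]
    refine Finset.sum_congr rfl fun τ _ => Finset.sum_congr rfl fun τ' _ => ?_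
    rw [kronJ_swap]
    ring
  have h1 : ∀ τ, rOp ℓ 1 t v τ * w τ = -(kNum ℓ (wt τ + t) 1 * v τ * w τ)
      + 1 / √2 * ((∑ τ', kronJ 1 τ τ' * v τ') * w τ) := by
    intro τ
    simp only [rOp, SignType.coe_one]
    ring
  have h2 : ∀ τ, v τ * rOp ℓ (-1) (t + 1) w τ = kNum ℓ (wt τ + t) 1 * v τ * w τ
      - 1 / √2 * (v τ * ∑ τ', kronJ (-1) τ τ' * w τ') := by
    intro τ
    simp only [rOp, SignType.coe_one, SignType.coe_neg, ← add_assoc, kNum_neg_succ]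
    ring
  simp only [h1, h2, Finset.sum_add_distrib, Finset.sum_sub_distrib, ← Finset.mul_sum, h,
    Finset.sum_neg_distrib]
  ring

variable (ℓ) in
/-- The array `v` of charge `0` is an eigenvector of the angular Laplacian, with eigenvalue
`-2 * μ`. -/
structure IsEigen (μ : ℝ) (v : MIdx n → ℝ) : Prop where
  supp : Supp ℓ 0 v
  pos_neg : rOp ℓ 1 (-1) (rOp ℓ (-1) 0 v) = -μ • v

namespace IsEigen
variable {μ : ℝ} {v : MIdx n → ℝ}

theorem neg_pos (h : IsEigen ℓ μ v) : rOp ℓ (-1) 1 (rOp ℓ 1 0 v) = -μ • v := by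
  have := rOp_commutator h.supp
  simp only [zero_sub, zero_add, h.pos_neg] at this
  push_cast at this
  linear_combination (norm := module) -this

/-- The commutator is applied to R_-v, which has charge -1; the summand 1 is minus that charge. -/
theorem pos_neg_neg (h : IsEigen ℓ μ v) : rOp ℓ 1 (-2) (rOp ℓ (-1) (-1) (rOp ℓ (-1) 0 v)) = (1 - μ) • rOp ℓ (-1) 0 v := by
  have := rOp_commutator (h.supp.rOp (-1))
  simp only [zero_add, SignType.coe_neg, SignType.coe_one, neg_add_cancel, h.pos_neg, rOp_smul,
    show (-1 - 1 : ℤ) = -2 by norm_num] at this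
  push_cast at this
  linear_combination (norm := module) this

/-- By skew-adjointness the squared norm of R_-v equals -⟨R_+R_-v, v⟩, which is 0 for eigenvalue 0.
This rescues degree L = 0, where the normalising roots of the recursion vanish. -/
theorem rOp_neg_eq_zero (h : IsEigen ℓ μ v) (h0 : μ = 0) : rOp ℓ (-1) 0 v = 0 := by
  have h1 := sum_rOp_mul (ℓ := ℓ) (-1) (rOp ℓ (-1) 0 v) v
  simp only [h.pos_neg, h0, neg_add_cancel] at h1
  have h2 : ∑ τ, rOp ℓ (-1) 0 v τ * rOp ℓ (-1) 0 v τ = 0 := by simpa using h1.symm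
  rw [Finset.sum_eq_zero_iff_of_nonneg fun _ _ => mul_self_nonneg _] at h2
  ext τ
  exact mul_self_eq_zero.1 (h2 τ (Finset.mem_univ _))

theorem rOp_pos_eq_zero (h : IsEigen ℓ μ v) (h0 : μ = 0) : rOp ℓ 1 0 v = 0 := by
  have h1 := sum_rOp_mul (ℓ := ℓ) 0 v (rOp ℓ 1 0 v)
  simp only [zero_add, h.neg_pos, h0] at h1
  have h2 : ∑ τ, rOp ℓ 1 0 v τ * rOp ℓ 1 0 v τ = 0 := by simpa using h1
  rw [Finset.sum_eq_zero_iff_of_nonneg fun _ _ => mul_self_nonneg _] at h2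
  ext τ
  exact mul_self_eq_zero.1 (h2 τ (Finset.mem_univ _))

theorem rOp_eq_zero (h : IsEigen ℓ μ v) (h0 : μ = 0) (σ : SignType) : rOp ℓ σ 0 v = 0 := by
  cases σ
  · exact rOp_zero_left ℓ 0 v
  · exact h.rOp_neg_eq_zero h0
  · exact h.rOp_pos_eq_zero h0

variable {w : MIdx (n + 1) → ℝ} {y x z : ℝ}

/-- On arrays with slices (y R_-v, x v, z R_+v), the operator R_+R_- acts as a 3 × 3 matrix on (y,
x, z); `h1`, `h2` and `h3` are the rows of its eigenvalue equation. -/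
theorem succ (h : IsEigen ℓ μ v) (hy : slice w (-1) = y • rOp ℓ (-1) 0 v)
    (hx : slice w 0 = x • v) (hz : slice w 1 = z • rOp ℓ 1 0 v) {μ' : ℝ}
    (h1 : y * μ + x = μ' * y) (h2 : z * μ + x = μ' * z)
    (h3 : (x + y) * μ + z * μ + x = μ' * x) : IsEigen ℓ μ' w where
  supp := by
    intro τ hτ
    have : ∀ ρ : SignType, Supp ℓ (0 + ρ) (slice w ρ) := by
      rw [forall_signType, hy, hx, hz]
      refine ⟨fun τ hτ => ?_, fun τ hτ => ?_, fun τ hτ => ?_⟩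
      · rw [Pi.smul_apply, h.supp.rOp _ _ hτ, smul_zero]
      · rw [Pi.smul_apply, h.supp _ (by simpa using hτ), smul_zero]
      · rw [Pi.smul_apply, h.supp.rOp _ _ hτ, smul_zero]
    rw [← Fin.cons_self_tail τ] at hτ ⊢
    refine this _ (Fin.tail τ) ?_
    rw [wt_cons] at hτ
    convert hτ using 2
    ring
  pos_neg := by
    have hn := h.neg_pos
    have hp := h.pos_neg
    have hpp := h.pos_neg_neg
    apply ext_slice
    · simp only [slice_smul, slice_rOp_pos_neg, slice_rOp_neg_neg, slice_rOp_neg_zero, hy, hx,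
        rOp_smul, zero_sub, show (-1 - 1 : ℤ) = -2 by norm_num, hpp]
      match_scalars
      linear_combination -h1
    · simp only [slice_smul, slice_rOp_pos_zero, slice_rOp_neg_zero, slice_rOp_neg_pos, hy, hx, hz,
        rOp_smul, rOp_add, zero_add, hp, hn]
      match_scalars
      linear_combination -h3
    · simp only [slice_smul, slice_rOp_pos_pos, slice_rOp_neg_pos, hx, hz, neg_add_cancel,
        rOp_smul, rOp_sub, zero_add, hn]
      match_scalars
      linear_combination -h2

/-- This and `slice_neg_pos` give the slices met when two indices are contracted: a raising and a
lowering step compensate and return to `v`. -/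
theorem slice_pos_neg (h : IsEigen ℓ μ v) (hy : slice w (-1) = y • rOp ℓ (-1) 0 v)
    (hx : slice w 0 = x • v) :
    slice (rOp ℓ 1 0 w) (-1) = (-(y * μ + x)) • v := by
  simp only [slice_rOp_pos_neg, hy, hx, rOp_smul, zero_sub, h.pos_neg]
  module

theorem slice_neg_pos (h : IsEigen ℓ μ v) (hx : slice w 0 = x • v)
    (hz : slice w 1 = z • rOp ℓ 1 0 v) :
    slice (rOp ℓ (-1) 0 w) 1 = (-(z * μ + x)) • v := by
  simp only [slice_rOp_neg_pos, hz, hx, rOp_smul, zero_add, h.neg_pos]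
  module

end IsEigen

/-- The coefficient of `R` in the recursion for `Q`. -/
def coefR : SignType → SignType → ℝ → ℝ
  | .neg, _, L => -(√(L * (2 * L + 1)))⁻¹
  | .zero, σ, L => (σ : ℝ) * (√(L * (L + 1)))⁻¹
  | .pos, _, L => (√((L + 1) * (2 * L + 1)))⁻¹

/-- The coefficient of the identity in the recursion for `Q`. -/
def coefE : SignType → ℝ → ℝ
  | .neg, L => L * (√(L * (2 * L + 1)))⁻¹
  | .zero, _ => 0
  | .pos, L => (L + 1) * (√((L + 1) * (2 * L + 1)))⁻¹

variable (ℓ) in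
/-- The column of `Q` at a regularity multi-index. -/
def qCol (a : MIdx n) : MIdx n → ℝ := fun σ => qMat ℓ n σ a

theorem slice_qCol (a : SignType) (b : MIdx n) (σ : SignType) :
    slice (qCol ℓ (Fin.cons a b : MIdx (n + 1))) σ
      = ((if σ = 0 then 1 else 0) * coefE a (ℓ + wt b)) • qCol ℓ b
        + coefR a σ (ℓ + wt b) • rOp ℓ σ 0 (qCol ℓ b) := by
  ext τ
  simp only [slice, qCol, qMat, Fin.cons_zero, Fin.tail_cons, rCoef_eq_rOp]
  change _ = ((if σ = 0 then 1 else 0) * coefE a (ℓ + wt b)) * qMat ℓ n τ b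
    + coefR a σ (ℓ + wt b) * rOp ℓ σ 0 (fun τ => qMat ℓ n τ b) τ
  cases a <;> simp only [coefE, coefR] <;> ring

theorem slice_qCol_neg (a : SignType) (b : MIdx n) :
    slice (qCol ℓ (Fin.cons a b : MIdx (n + 1))) (-1)
      = coefR a (-1) (ℓ + wt b) • rOp ℓ (-1) 0 (qCol ℓ b) := by
  simp [slice_qCol]

theorem slice_qCol_zero (a : SignType) (b : MIdx n) :
    slice (qCol ℓ (Fin.cons a b : MIdx (n + 1))) 0 = coefE a (ℓ + wt b) • qCol ℓ b := by
  simp [slice_qCol, rOp_zero_left]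

theorem slice_qCol_pos (a : SignType) (b : MIdx n) :
    slice (qCol ℓ (Fin.cons a b : MIdx (n + 1))) 1
      = coefR a 1 (ℓ + wt b) • rOp ℓ 1 0 (qCol ℓ b) := by
  simp [slice_qCol]

/-- The three cases of the recursion solve the equations of `IsEigen.succ` with L replaced by L-1,
L, L+1. No admissibility is needed: the eigenvalue equation is homogeneous in (y, x, z), so
vanishing normalisers do no harm. -/
theorem isEigen_qCol : ∀ {n : ℕ} (a : MIdx n),
    IsEigen ℓ (((ℓ : ℝ) + wt a) * (ℓ + wt a + 1) / 2) (qCol ℓ a)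
  | 0, a => by
    constructor
    · intro τ hτ
      simp only [wt, Finset.univ_eq_empty, Finset.sum_empty, add_zero, abs_zero] at hτ
      omega
    · ext τ
      have h := kNum_pos_mul_neg ℓ (s := 0) (by simp)
      simp only [zero_sub] at h
      simp only [rOp, wt, kronJ, Pi.smul_apply, Finset.univ_eq_empty,
        Finset.sum_empty, zero_mul, Finset.sum_const_zero, mul_zero, add_zero, zero_add, smul_eq_mul]
      push_cast at h ⊢
      linear_combination (qCol ℓ a τ) * h
  | n + 1, a => by
    rw [← Fin.cons_self_tail a]
    refine (isEigen_qCol (Fin.tail a)).succ (slice_qCol_neg _ _) (slice_qCol_zero _ _)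
      (slice_qCol_pos _ _) ?_ ?_ ?_ <;> rw [wt_cons] <;> generalize a 0 = c <;> cases c <;>
      simp [coefR, coefE] <;> ring

/-- At the first forbidden entry L = 0, so its normaliser is the inverse of 0, hence 0; the
recursion then propagates the zero column. -/
theorem qCol_eq_zero : ∀ {n : ℕ} {a : MIdx n}, ¬ Admissible ℓ a → qCol ℓ a = 0
  | 0, a, h => absurd trivial h
  | n + 1, a, h => by
    rw [← Fin.cons_self_tail a]
    have key : ∀ σ, slice (qCol ℓ (Fin.cons (a 0) (Fin.tail a) : MIdx (n + 1))) σ = 0 := by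
      intro σ
      rw [slice_qCol]
      by_cases h' : Admissible ℓ (Fin.tail a)
      · have h2 : (ℓ : ℤ) + wt (Fin.tail a) = 0 ∧ a 0 ≠ 1 := by
          by_contra h3
          exact h ⟨h', fun h4 => by tauto⟩
        obtain ⟨h2, h3⟩ := h2
        have h4 : (ℓ : ℝ) + wt (Fin.tail a) = 0 := by exact_mod_cast h2
        rw [h4]
        generalize a 0 = c at *
        cases c
        · simp [coefR, coefE]
        · simp [coefR, coefE]
        · exact absurd rfl h3
      · rw [qCol_eq_zero h']
        have : rOp ℓ σ 0 (0 : MIdx n → ℝ) = 0 := by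
          ext τ
          simp [rOp]
        simp [this]
    exact ext_slice (key _) (key _) (key _)

theorem Admissible.nonneg : ∀ {n : ℕ} {a : MIdx n}, Admissible ℓ a → 0 ≤ (ℓ : ℤ) + wt a
  | 0, a, _ => by simp [wt]
  | n + 1, a, h => by
    have h1 := h.1.nonneg
    have h2 := h.2
    rw [← Fin.cons_self_tail a, wt_cons]
    generalize a 0 = c at *
    cases c <;> simp at h2 ⊢ <;> omega

/-- The contraction of the first two indices of `Q`, as a scalar multiple of a column. -/
theorem sum_qCol_cons_cons (a b : SignType) (c κ : MIdx n) :
    ∑ σ : SignType, qCol ℓ (Fin.cons a (Fin.cons b c : MIdx (n + 1)) : MIdx (n + 2))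
        (Fin.cons σ (Fin.cons (-σ) κ : MIdx (n + 1)))
      = (let L : ℝ := ℓ + wt c;
        let L' : ℝ := ℓ + b + wt c;
        let μ : ℝ := L * (L + 1) / 2;
        -coefR a (-1) L' * (coefR b 1 L * μ + coefE b L) + coefE a L' * coefE b L
          - coefR a 1 L' * (coefR b (-1) L * μ + coefE b L)) * qCol ℓ c κ := by
  have h := isEigen_qCol (ℓ := ℓ) c
  have h1 := h.slice_neg_pos (slice_qCol_zero b c) (slice_qCol_pos b c)
  have h2 := h.slice_pos_neg (slice_qCol_neg b c) (slice_qCol_zero b c)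
  have e : ∀ σ, qCol ℓ (Fin.cons a (Fin.cons b c : MIdx (n + 1)) : MIdx (n + 2))
        (Fin.cons σ (Fin.cons (-σ) κ : MIdx (n + 1)))
      = slice (slice (qCol ℓ (Fin.cons a (Fin.cons b c : MIdx (n + 1)) : MIdx (n + 2))) σ) (-σ) κ :=
    fun _ => rfl
  simp only [e, sum_signType]
  rw [slice_qCol_neg, slice_qCol_zero, slice_qCol_pos]
  simp only [slice_smul, neg_neg, neg_zero, h1, h2, slice_qCol_zero, wt_cons, Pi.smul_apply,
    smul_eq_mul]
  push_cast
  rw [← add_assoc]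
  ring

end
end BallTensor
end

/-! ### The contraction formulas. -/

open scoped BigOperators
noncomputable section
namespace BallTensor

/-- The scalar of `sum_qCol_cons_cons`. For `a ≠ -b` the terms cancel; otherwise it is an identity
between square roots. The condition `hb` expresses admissibility, and `h1` records that `L` stands
for an integer. -/
theorem coef_contract (a b : SignType) {L : ℝ} (h0 : 0 ≤ L) (h1 : L ≠ 0 → 1 ≤ L)
    (hb : L = 0 → b = 1) :
    -coefR a (-1) (L + b) * (coefR b 1 L * (L * (L + 1) / 2) + coefE b L)
        + coefE a (L + b) * coefE b L
        - coefR a 1 (L + b) * (coefR b (-1) L * (L * (L + 1) / 2) + coefE b L)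
      = (if a = -b then (1 : ℝ) else 0) * √((2 * (L + b) + 1) / (2 * L + 1)) := by
  have hL1 : 0 < L + 1 := by linarith
  have hL2 : 0 < 2 * L + 1 := by linarith
  cases b
  · have hL : L ≠ 0 := fun h => by simpa using hb h
    have hL' : 0 < L := lt_of_le_of_ne h0 (Ne.symm hL)
    cases a
    · have h1 : 0 ≤ L * (L + 1) := by positivity
      have h2 : √(L * (L + 1)) ≠ 0 := by positivity
      simp [coefR, coefE, hL2.ne']
      field_simp
      rw [Real.sq_sqrt h1]
      norm_num
    · simp [coefR, coefE]
    · simp [coefR, coefE]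
  · have hL : L ≠ 0 := fun h => by simpa using hb h
    have hL' : 1 ≤ L := h1 hL
    cases a
    · simp [coefR, coefE]
    · simp [coefR, coefE]
      ring
    · have h3 : 0 < 2 * L - 1 := by linarith
      simp [coefR, coefE]
      rw [show 2 * (L + -1) + 1 = 2 * L - 1 by ring,
        Real.sqrt_mul h0, Real.sqrt_mul h0, Real.sqrt_div h3.le]
      have h4 : √L ≠ 0 := by positivity
      have h5 : √(2 * L + 1) ≠ 0 := by positivity
      have h6 : √(2 * L - 1) ≠ 0 := by positivity
      have e1 := Real.sq_sqrt h0
      have e2 := Real.sq_sqrt h3.le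
      field_simp
      rw [e1, e2]
      ring
  · cases a
    · simp [coefR, coefE]
    · have h3 : 0 < 2 * L + 3 := by linarith
      simp [coefR, coefE]
      rw [show 2 * (L + 1) + 1 = 2 * L + 3 by ring,
        Real.sqrt_mul hL1.le, Real.sqrt_mul hL1.le, Real.sqrt_div h3.le]
      have h4 : √(L + 1) ≠ 0 := by positivity
      have h5 : √(2 * L + 1) ≠ 0 := by positivity
      have h6 : √(2 * L + 3) ≠ 0 := by positivity
      have e1 := Real.sq_sqrt hL1.le
      have e2 := Real.sq_sqrt h3.le
      field_simp
      rw [e1, mul_comm L 2, e2]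
      ring
    · simp [coefR, coefE]
      ring

theorem sum_signType_ite (f : SignType → SignType → ℝ) :
    ∑ σ : SignType, ∑ τ : SignType, (if σ = -τ then (1 : ℝ) else 0) * f σ τ
      = ∑ σ : SignType, f σ (-σ) := by
  simp [sum_signType]

theorem contraction {n ℓ : ℕ} (a b : SignType) (c κ : MIdx n)
    (h : Admissible ℓ (Fin.cons b c : MIdx (n + 1))) :
    ∑ σ : SignType, qMat ℓ (n + 2) (Fin.cons σ (Fin.cons (-σ) κ : MIdx (n + 1)))
        (Fin.cons a (Fin.cons b c : MIdx (n + 1)))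
      = (if a = -b then (1 : ℝ) else 0)
          * √((2 * ((ℓ : ℝ) + (b : ℝ) + (wt c : ℝ)) + 1) / (2 * ((ℓ : ℝ) + (wt c : ℝ)) + 1))
          * qMat ℓ n κ c := by
  have h0 : 0 ≤ (ℓ : ℤ) + wt c := Admissible.nonneg (by simpa using h.1)
  have hb := h.2
  simp only [Fin.tail_cons, Fin.cons_zero] at hb
  have key := coef_contract a b (L := ((ℓ : ℤ) + wt c : ℤ)) (by exact_mod_cast h0)
    (fun h1 => by
      have : (ℓ : ℤ) + wt c ≠ 0 := by exact_mod_cast h1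
      exact_mod_cast (by omega : 1 ≤ (ℓ : ℤ) + wt c)) (fun h1 => hb (by exact_mod_cast h1))
  have h1 := sum_qCol_cons_cons (ℓ := ℓ) a b c κ
  push_cast at key
  simp only [show (ℓ : ℝ) + wt c + b = ℓ + b + wt c by ring] at key
  simp only [qCol] at h1
  rw [h1, key]

/-- Admissibility can be dropped here: if only `b` is forbidden, then its degree is 0 and ξ^b_0 = 0;
if `c` is not admissible, all columns vanish. The divergence formula can thus sum over all indices.
-/
theorem contraction_xi {n ℓ : ℕ} (a b : SignType) (c κ : MIdx n) :
    xi a ((ℓ : ℤ) + (b : ℤ) + wt c) *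
      ∑ σ : SignType, qMat ℓ (n + 2) (Fin.cons σ (Fin.cons (-σ) κ : MIdx (n + 1)))
        (Fin.cons a (Fin.cons b c : MIdx (n + 1)))
      = (if a = -b then (1 : ℝ) else 0) * xi b ((ℓ : ℤ) + wt c) * qMat ℓ n κ c := by
  by_cases hc : Admissible ℓ c
  · have h0 := hc.nonneg
    by_cases h : Admissible ℓ (Fin.cons b c : MIdx (n + 1))
    · rw [contraction a b c κ h]
      by_cases hab : a = -b
      · have hb := h.2
        simp only [Fin.tail_cons, Fin.cons_zero] at hb
        have h0' : (0 : ℝ) ≤ ((ℓ : ℤ) + wt c : ℤ) := by exact_mod_cast h0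
        rw [show (ℓ : ℤ) + b + wt c = ((ℓ : ℤ) + wt c) + b by ring,
          show (ℓ : ℝ) + b + wt c = ((ℓ : ℤ) + wt c : ℤ) + b by push_cast; ring,
          show (ℓ : ℝ) + wt c = ((ℓ : ℤ) + wt c : ℤ) by push_cast; ring]
        simp only [hab, if_true, one_mul]
        rw [← mul_assoc]
        congr 1
        generalize (ℓ : ℤ) + wt c = L at *
        cases b
        · simp [xi]
        · have h1 : L ≠ 0 := fun h1 => by simpa using hb h1
          have h2 : (1 : ℝ) ≤ L := by exact_mod_cast (by omega : 1 ≤ L)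
          have h3 : (0 : ℝ) < 2 * L - 1 := by linarith
          have h4 : 2 * ((L : ℝ) + -1) + 1 = 2 * L - 1 := by ring
          simp only [SignType.neg_eq_neg_one, neg_neg, SignType.coe_neg, SignType.coe_one]
          change √((((L + -1 : ℤ) : ℝ) + 1) / (2 * ((L + -1 : ℤ) : ℝ) + 1)) * _ = √((L : ℝ) / (2 * L + 1))
          push_cast
          rw [h4, neg_add_cancel_right, ← Real.sqrt_mul (by positivity)]
          rw [div_mul_div_cancel₀ h3.ne']
        · have h4 : 2 * ((L : ℝ) + 1) + 1 = 2 * L + 3 := by ring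
          simp only [SignType.pos_eq_one, SignType.coe_one]
          change √(((L + 1 : ℤ) : ℝ) / (2 * ((L + 1 : ℤ) : ℝ) + 1)) * _
            = √(((L : ℝ) + 1) / (2 * L + 1))
          push_cast
          rw [h4, ← Real.sqrt_mul (by positivity)]
          congr 1
          field_simp
      · simp [hab]
    · have h2 : (ℓ : ℤ) + wt c = 0 ∧ b ≠ 1 := by
        by_contra h3
        refine h ⟨by simpa using hc, fun h4 => ?_⟩
        simp only [Fin.tail_cons, Fin.cons_zero] at h4 ⊢
        tauto
      have h3 : ¬ Admissible ℓ (Fin.cons a (Fin.cons b c : MIdx (n + 1)) : MIdx (n + 2)) :=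
        fun h3 => h (by simpa using h3.1)
      have h4 : ∀ σ, qMat ℓ (n + 2) σ (Fin.cons a (Fin.cons b c : MIdx (n + 1))) = 0 :=
        congrFun (qCol_eq_zero h3)
      have h5 : xi b 0 = 0 := by
        have := h2.2
        cases b <;> simp [xi] at this ⊢
      simp [h4, h2.1, h5]
  · have h3 : ¬ Admissible ℓ (Fin.cons a (Fin.cons b c : MIdx (n + 1)) : MIdx (n + 2)) :=
      fun h3 => hc (by simpa using h3.1.1)
    have h4 : ∀ σ, qMat ℓ (n + 2) σ (Fin.cons a (Fin.cons b c : MIdx (n + 1))) = 0 :=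
      congrFun (qCol_eq_zero h3)
    have h5 : ∀ σ, qMat ℓ n σ c = 0 := congrFun (qCol_eq_zero hc)
    simp [h4, h5]

end BallTensor
end

/-! ### Half-angle rotations of binary forms. -/

open scoped BigOperators
noncomputable section
namespace BallTensor

open Polynomial

/-- Coefficientwise differentiability of a curve of polynomials. -/
def HasCoeffDeriv (F : ℝ → ℝ[X]) (F' : ℝ[X]) (θ : ℝ) : Prop :=
  ∀ i, HasDerivAt (fun t => (F t).coeff i) (F'.coeff i) θ

theorem HasCoeffDeriv.mul {F G : ℝ → ℝ[X]} {F' G' : ℝ[X]} {θ : ℝ} (hF : HasCoeffDeriv F F' θ)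
    (hG : HasCoeffDeriv G G' θ) :
    HasCoeffDeriv (fun t => F t * G t) (F' * G θ + F θ * G') θ := by
  intro i
  simp only [coeff_mul, coeff_add, ← Finset.sum_add_distrib]
  exact HasDerivAt.fun_sum fun x _ => (hF x.1).mul (hG x.2)

theorem HasCoeffDeriv.pow {F : ℝ → ℝ[X]} {F' : ℝ[X]} {θ : ℝ} (hF : HasCoeffDeriv F F' θ) :
    ∀ n : ℕ, HasCoeffDeriv (fun t => F t ^ n) (C (n : ℝ) * F θ ^ (n - 1) * F') θ
  | 0 => fun i => by simpa using hasDerivAt_const θ _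
  | 1 => by simpa using hF
  | n + 2 => by
    have h := (hF.pow (n + 1)).mul hF
    simp only [← pow_succ, add_tsub_cancel_right] at h ⊢
    convert h using 1
    simp only [Nat.cast_add, Nat.cast_one, Nat.cast_ofNat, C_add, map_one, map_ofNat]
    rw [show n + 2 - 1 = n + 1 by omega]
    ring

/-- The rotation of the first variable by a half angle. -/
def rotA (θ : ℝ) : ℝ[X] := C (Real.cos (θ / 2)) + C (Real.sin (θ / 2)) * X

/-- The rotation of the second variable by a half angle. -/
def rotB (θ : ℝ) : ℝ[X] := C (-Real.sin (θ / 2)) + C (Real.cos (θ / 2)) * X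

theorem hasCoeffDeriv_rotA (θ : ℝ) : HasCoeffDeriv rotA (C (1 / 2) * rotB θ) θ := by
  intro i
  have h2 : HasDerivAt (fun t : ℝ => t / 2) (1 / 2) θ := (hasDerivAt_id θ).div_const 2
  have hs := (Real.hasDerivAt_sin (θ / 2)).comp θ h2
  have hc := (Real.hasDerivAt_cos (θ / 2)).comp θ h2
  rcases i with _ | _ | i
  · simp [rotA, rotB]
    exact hc.congr_deriv (by ring)
  · simp [rotA, rotB, coeff_C]
    exact hs.congr_deriv (by ring)
  · simp [rotA, rotB]
    exact hasDerivAt_const _ _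

theorem hasCoeffDeriv_rotB (θ : ℝ) : HasCoeffDeriv rotB (C (-(1 / 2)) * rotA θ) θ := by
  intro i
  have h2 : HasDerivAt (fun t : ℝ => t / 2) (1 / 2) θ := (hasDerivAt_id θ).div_const 2
  have hs := (Real.hasDerivAt_sin (θ / 2)).comp θ h2
  have hc := (Real.hasDerivAt_cos (θ / 2)).comp θ h2
  rcases i with _ | _ | i
  · simp [rotA, rotB]
    exact hs.neg.congr_deriv (by ring)
  · simp [rotA, rotB, coeff_C]
    exact hc.congr_deriv (by ring)
  · simp [rotA, rotB]
    exact hasDerivAt_const _ _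

/-- The matrix elements of rotations of binary forms of degree `p + q`. -/
def wigC (p q i : ℕ) (θ : ℝ) : ℝ := (rotA θ ^ p * rotB θ ^ q).coeff i

/-- The derivative of the rotation turns a factor `rotA` into `rotB` / 2 and a factor `rotB` into
-`rotA` / 2, which moves (p, q) one step along the ladder. -/
theorem hasDerivAt_wigC (p q i : ℕ) (θ : ℝ) :
    HasDerivAt (wigC p q i)
      (p / 2 * wigC (p - 1) (q + 1) i θ - q / 2 * wigC (p + 1) (q - 1) i θ) θ := by
  have h := ((hasCoeffDeriv_rotA θ).pow p).mul ((hasCoeffDeriv_rotB θ).pow q) i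
  refine h.congr_deriv ?_
  simp only [wigC]
  rw [show C (p : ℝ) * rotA θ ^ (p - 1) * (C (1 / 2) * rotB θ) * rotB θ ^ q
      + rotA θ ^ p * (C (q : ℝ) * rotB θ ^ (q - 1) * (C (-(1 / 2)) * rotA θ))
      = C (p / 2 : ℝ) * (rotA θ ^ (p - 1) * rotB θ ^ (q + 1))
        - C (q / 2 : ℝ) * (rotA θ ^ (p + 1) * rotB θ ^ (q - 1)) by
    rw [div_eq_mul_one_div (p : ℝ), div_eq_mul_one_div (q : ℝ), C_mul, C_mul, C_neg]
    ring]
  simp only [coeff_sub, coeff_C_mul]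

theorem rotA_sub (θ : ℝ) : rotA θ - 2 * X * derivative (rotA θ)
    = C (Real.cos θ) * rotA θ - C (Real.sin θ) * rotB θ := by
  have h1 : Real.cos θ = Real.cos (θ / 2) ^ 2 - Real.sin (θ / 2) ^ 2 := by
    rw [← Real.cos_two_mul', mul_div_cancel₀ _ two_ne_zero]
  have h2 : Real.sin θ = 2 * Real.sin (θ / 2) * Real.cos (θ / 2) := by
    rw [← Real.sin_two_mul, mul_div_cancel₀ _ two_ne_zero]
  have h3 : C (Real.sin (θ / 2)) ^ 2 + C (Real.cos (θ / 2)) ^ 2 = (1 : ℝ[X]) := by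
    rw [← C_pow, ← C_pow, ← C_add, Real.sin_sq_add_cos_sq, C_1]
  simp only [rotA, rotB, h1, h2, derivative_add, derivative_C, derivative_mul, derivative_X, C_sub,
    C_pow, C_mul, C_neg, map_ofNat]
  linear_combination (-C (Real.cos (θ / 2)) + C (Real.sin (θ / 2)) * X) * h3

theorem rotB_sub (θ : ℝ) : rotB θ - 2 * X * derivative (rotB θ)
    = -C (Real.sin θ) * rotA θ - C (Real.cos θ) * rotB θ := by
  have h1 : Real.cos θ = Real.cos (θ / 2) ^ 2 - Real.sin (θ / 2) ^ 2 := by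
    rw [← Real.cos_two_mul', mul_div_cancel₀ _ two_ne_zero]
  have h2 : Real.sin θ = 2 * Real.sin (θ / 2) * Real.cos (θ / 2) := by
    rw [← Real.sin_two_mul, mul_div_cancel₀ _ two_ne_zero]
  have h3 : C (Real.sin (θ / 2)) ^ 2 + C (Real.cos (θ / 2)) ^ 2 = (1 : ℝ[X]) := by
    rw [← C_pow, ← C_pow, ← C_add, Real.sin_sq_add_cos_sq, C_1]
  simp only [rotA, rotB, h1, h2, derivative_add, derivative_C, derivative_mul, derivative_X, C_sub,
    C_pow, C_mul, C_neg, map_ofNat]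
  rw [← C_neg, derivative_C, C_neg]
  linear_combination (C (Real.sin (θ / 2)) + C (Real.cos (θ / 2)) * X) * h3

theorem coeff_two_X_mul_derivative (f : ℝ[X]) (i : ℕ) :
    (2 * X * derivative f).coeff i = 2 * i * f.coeff i := by
  rw [mul_assoc, ← map_ofNat C 2, coeff_C_mul]
  cases i with
  | zero => simp
  | succ i =>
    rw [coeff_X_mul, coeff_derivative]
    push_cast
    ring

/-- The weight operator (p+q) - 2X d/dX multiplies the i-th coefficient by p+q-2i. Applied to the
product by the Leibniz rule, it acts on each rotated linear form as in `rotA_sub` and `rotB_sub`.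
This is the second ladder relation, independent of the θ-derivative. -/
theorem wigC_euler (p q i : ℕ) (θ : ℝ) :
    ((p : ℝ) + q - 2 * i) * wigC p q i θ
      = p * (Real.cos θ * wigC p q i θ - Real.sin θ * wigC (p - 1) (q + 1) i θ)
        - q * (Real.sin θ * wigC (p + 1) (q - 1) i θ + Real.cos θ * wigC p q i θ) := by
  -- The factor `p` hides the truncated exponent `p - 1` at `p = 0`.
  have hA : C (p : ℝ) * rotA θ ^ p = C (p : ℝ) * rotA θ ^ (p - 1) * rotA θ := by
    cases p <;> simp [pow_succ, mul_assoc]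
  have hB : C (q : ℝ) * rotB θ ^ q = C (q : ℝ) * rotB θ ^ (q - 1) * rotB θ := by
    cases q <;> simp [pow_succ, mul_assoc]
  have key : C ((p : ℝ) + q) * (rotA θ ^ p * rotB θ ^ q)
        - 2 * X * derivative (rotA θ ^ p * rotB θ ^ q)
      = C (p : ℝ) * (C (Real.cos θ) * (rotA θ ^ p * rotB θ ^ q)
          - C (Real.sin θ) * (rotA θ ^ (p - 1) * rotB θ ^ (q + 1)))
        - C (q : ℝ) * (C (Real.sin θ) * (rotA θ ^ (p + 1) * rotB θ ^ (q - 1))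
          + C (Real.cos θ) * (rotA θ ^ p * rotB θ ^ q)) := by
    rw [derivative_mul, derivative_pow, derivative_pow, C_add]
    linear_combination (C (p : ℝ) * rotA θ ^ (p - 1) * rotB θ ^ q) * rotA_sub θ
      + (C (q : ℝ) * rotB θ ^ (q - 1) * rotA θ ^ p) * rotB_sub θ
      + (1 - C (Real.cos θ)) * rotB θ ^ q * hA + (1 + C (Real.cos θ)) * rotA θ ^ p * hB
  have h := congrArg (fun f => coeff f i) key
  simp only [coeff_sub, coeff_add, coeff_C_mul, coeff_two_X_mul_derivative] at h
  simp only [wigC]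
  linear_combination h

theorem coeff_add_mul_X_pow (a b : ℝ) (p j : ℕ) :
    ((C a + C b * X) ^ p).coeff j = (p.choose j : ℝ) * a ^ (p - j) * b ^ j := by
  have h : (C a + C b * X : ℝ[X]) ^ p = ((X + C a) ^ p).comp (C b * X) := by
    simp [add_comm]
  rw [h, comp_C_mul_X_coeff, coeff_X_add_C_pow]
  ring

end BallTensor
end

/-! ### Spin-weighted harmonics as rotation matrix elements. -/

open scoped BigOperators
noncomputable section
namespace BallTensor

theorem wigC_eq_sum (p q i : ℕ) (θ : ℝ) :
    wigC p q i θ = ∑ j ∈ Finset.range (i + 1),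
      ((p.choose j : ℝ) * Real.cos (θ / 2) ^ (p - j) * Real.sin (θ / 2) ^ j)
        * ((q.choose (i - j) : ℝ) * (-Real.sin (θ / 2)) ^ (q - (i - j))
          * Real.cos (θ / 2) ^ (i - j)) := by
  simp only [wigC, rotA, rotB, Polynomial.coeff_mul, coeff_add_mul_X_pow]
  rw [Finset.Nat.sum_antidiagonal_eq_sum_range_succ_mk]

theorem jacobiP_cos (k a b : ℕ) (θ : ℝ) :
    jacobiP k a b (Real.cos θ) = ∑ j ∈ Finset.range (k + 1),
      ((k + a).choose (k - j) : ℝ) * ((k + b).choose j : ℝ)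
        * (-Real.sin (θ / 2) ^ 2) ^ j * (Real.cos (θ / 2) ^ 2) ^ (k - j) := by
  have h1 : Real.cos θ = 2 * Real.cos (θ / 2) ^ 2 - 1 := by
    rw [← Real.cos_two_mul, mul_div_cancel₀ _ two_ne_zero]
  have h2 := Real.sin_sq_add_cos_sq (θ / 2)
  rw [jacobiP, show (Real.cos θ - 1) / 2 = -Real.sin (θ / 2) ^ 2 by linarith,
    show (Real.cos θ + 1) / 2 = Real.cos (θ / 2) ^ 2 by linarith]

theorem sum_range_window {f : ℕ → ℝ} {a k N : ℕ} (hN : a + k ≤ N) (h1 : ∀ j < a, f j = 0)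
    (h2 : ∀ j ≤ N, a + k < j → f j = 0) :
    ∑ j ∈ Finset.range (N + 1), f j = ∑ j ∈ Finset.range (k + 1), f (a + j) := by
  obtain ⟨r, rfl⟩ := Nat.exists_eq_add_of_le hN
  rw [show a + k + r + 1 = a + (k + 1 + r) by ring, Finset.sum_range_add, Finset.sum_range_add,
    Finset.sum_eq_zero fun j hj => h1 j (Finset.mem_range.1 hj), zero_add,
    Finset.sum_eq_zero (s := Finset.range r) fun j hj => h2 _
      (by have := Finset.mem_range.1 hj; omega) (by omega), add_zero]

/-- The four lemmas `wigC_top`, `wigC_bot`, `wigC_left`, `wigC_right` cover the cases ℓ_0 = m, -m,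
s, -s of the Jacobi formula. In each, the binomials vanish outside a window of k+1 terms, which
match the Jacobi sum one by one in powers of the half-angle sine and cosine. -/
theorem wigC_top (k a b : ℕ) (θ : ℝ) :
    wigC (k + b) (k + a) k θ = (-1) ^ a * Real.sin (θ / 2) ^ a * Real.cos (θ / 2) ^ b
      * jacobiP k a b (Real.cos θ) := by
  rw [wigC_eq_sum, jacobiP_cos, Finset.mul_sum]
  refine Finset.sum_congr rfl fun j hj => ?_
  obtain ⟨d, rfl⟩ := Nat.exists_eq_add_of_le (Nat.lt_succ_iff.1 (Finset.mem_range.1 hj))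
  rw [show j + d + b - j = d + b by omega, show j + d - j = d by omega,
    show j + d + a - d = j + a by omega, neg_pow, neg_pow (Real.sin (θ / 2) ^ 2)]
  ring

theorem wigC_bot (k a b : ℕ) (θ : ℝ) :
    wigC (k + a) (k + b) (k + a + b) θ = Real.sin (θ / 2) ^ a * Real.cos (θ / 2) ^ b
      * jacobiP k a b (Real.cos θ) := by
  rw [wigC_eq_sum, sum_range_window (a := a) (k := k) (by omega), jacobiP_cos, Finset.mul_sum]
  · refine Finset.sum_congr rfl fun j hj => ?_
    obtain ⟨d, rfl⟩ := Nat.exists_eq_add_of_le (Nat.lt_succ_iff.1 (Finset.mem_range.1 hj))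
    rw [show j + d + a - (a + j) = d by omega, show j + d - j = d by omega,
      show j + d + a + b - (a + j) = d + b by omega, show j + d + b - (d + b) = j by omega,
      neg_pow, neg_pow (Real.sin (θ / 2) ^ 2),
      Nat.choose_symm_of_eq_add (show j + d + a = (a + j) + d by ring),
      Nat.choose_symm_of_eq_add (show j + d + b = (d + b) + j by ring)]
    ring
  · intro j hj
    rw [Nat.choose_eq_zero_of_lt (show k + b < k + a + b - j by omega)]
    simp
  · intro j _ hj
    rw [Nat.choose_eq_zero_of_lt (show k + a < j by omega)]
    simp

/-- The factorials appear because the Jacobi form is attached to the pair with m and s exchanged,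
and `wigC` is symmetric under this exchange only after normalisation. -/
theorem wigC_left (k a b : ℕ) (θ : ℝ) :
    ((k + a).factorial * (k + b).factorial : ℝ) * wigC k (k + a + b) (k + b) θ
      = ((k + a + b).factorial * k.factorial : ℝ) * ((-1) ^ a * Real.sin (θ / 2) ^ a
        * Real.cos (θ / 2) ^ b * jacobiP k a b (Real.cos θ)) := by
  rw [wigC_eq_sum, sum_range_window (a := 0) (k := k) (by omega) (by simp), jacobiP_cos,
    Finset.mul_sum, Finset.mul_sum, Finset.mul_sum]
  · refine Finset.sum_congr rfl fun j hj => ?_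
    obtain ⟨d, rfl⟩ := Nat.exists_eq_add_of_le (Nat.lt_succ_iff.1 (Finset.mem_range.1 hj))
    rw [zero_add, show j + d - j = d by omega, show j + d + b - j = d + b by omega,
      show j + d + a + b - (d + b) = j + a by omega, neg_pow, neg_pow (Real.sin (θ / 2) ^ 2),
      show j + d + a + b = (d + b) + (j + a) by ring, show j + d + a = d + (j + a) by ring,
      show j + d + b = j + (d + b) by ring, Nat.cast_add_choose ℝ, Nat.cast_add_choose ℝ,
      Nat.cast_add_choose ℝ, Nat.cast_add_choose ℝ]
    have h : ∀ n : ℕ, (n.factorial : ℝ) ≠ 0 := fun n => by positivity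
    have h1 := h (j + a); have h2 := h (d + b); have h3 := h j; have h4 := h d
    field_simp
    ring
  · intro j _ hj
    rw [Nat.choose_eq_zero_of_lt (show k < j by omega)]
    simp

theorem wigC_right (k a b : ℕ) (θ : ℝ) :
    ((k + a).factorial * (k + b).factorial : ℝ) * wigC (k + a + b) k (k + a) θ
      = ((k + a + b).factorial * k.factorial : ℝ) * (Real.sin (θ / 2) ^ a
        * Real.cos (θ / 2) ^ b * jacobiP k a b (Real.cos θ)) := by
  rw [wigC_eq_sum, sum_range_window (a := a) (k := k) (by omega), jacobiP_cos,
    Finset.mul_sum, Finset.mul_sum, Finset.mul_sum]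
  · refine Finset.sum_congr rfl fun j hj => ?_
    obtain ⟨d, rfl⟩ := Nat.exists_eq_add_of_le (Nat.lt_succ_iff.1 (Finset.mem_range.1 hj))
    rw [show j + d + a + b - (a + j) = d + b by omega, show j + d - j = d by omega,
      show j + d + a - (a + j) = d by omega, show j + d - d = j by omega,
      neg_pow, neg_pow (Real.sin (θ / 2) ^ 2),
      Nat.choose_symm_of_eq_add (show j + d = d + j by ring),
      show j + d + a + b = (a + j) + (d + b) by ring, show j + d + a = d + (a + j) by ring,
      show j + d + b = j + (d + b) by ring, Nat.cast_add_choose ℝ, Nat.cast_add_choose ℝ,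
      Nat.cast_add_choose ℝ, Nat.cast_add_choose ℝ]
    have h : ∀ n : ℕ, (n.factorial : ℝ) ≠ 0 := fun n => by positivity
    have h1 := h (a + j); have h2 := h (d + b); have h3 := h j; have h4 := h d
    field_simp
    ring
  · intro j hj
    rw [Nat.choose_eq_zero_of_lt (show k < k + a - j by omega)]
    simp
  · intro j hj hj'
    omega

/-- The dependence of the harmonics on the colatitude, in terms of rotations of binary forms. -/
def wigY (ℓ : ℕ) (m s : ℤ) (θ : ℝ) : ℝ :=
  if |s| ≤ ℓ then
    (-1 : ℝ) ^ s * √((2 * (ℓ : ℝ) + 1) * (((ℓ : ℤ) + m).toNat.factorial * ((ℓ : ℤ) - m).toNat.factorial)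
        / (2 * (((ℓ : ℤ) + s).toNat.factorial * ((ℓ : ℤ) - s).toNat.factorial)))
      * wigC ((ℓ : ℤ) - s).toNat ((ℓ : ℤ) + s).toNat ((ℓ : ℤ) - m).toNat θ
  else 0

/-- Passes between the normalisations of (m, s) and (s, m) when |s| is the larger of the two. -/
theorem sqrt_ratio_mul {D U V J c : ℝ} (hD : 0 ≤ D) (hU : 0 < U) (hV : 0 < V) (h : V * c = U * J) :
    √(D * U / (2 * V)) * J = √(D * V / (2 * U)) * c := by
  have h1 : D * V / (2 * U) = D * U / (2 * V) * (V / U) ^ 2 := by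
    field_simp
  rw [h1, Real.sqrt_mul (by positivity), Real.sqrt_sq (by positivity)]
  have h2 : J = V * c / U := by rw [h]; field_simp
  rw [h2]
  ring

theorem factorial_natAbs {ℓ : ℕ} {s : ℤ} (h : |s| ≤ ℓ) :
    ((ℓ + s.natAbs).factorial : ℝ) * ((ℓ - s.natAbs).factorial : ℝ)
      = ((ℓ : ℤ) + s).toNat.factorial * ((ℓ : ℤ) - s).toNat.factorial := by
  rw [abs_le] at h
  rcases le_total 0 s with h0 | h0
  · rw [show ((ℓ : ℤ) + s).toNat = ℓ + s.natAbs by omega,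
      show ((ℓ : ℤ) - s).toNat = ℓ - s.natAbs by omega]
  · rw [show ((ℓ : ℤ) + s).toNat = ℓ - s.natAbs by omega,
      show ((ℓ : ℤ) - s).toNat = ℓ + s.natAbs by omega, mul_comm]

theorem sphY_eq {ℓ : ℕ} {m : ℤ} (hm : |m| ≤ ℓ) (s : ℤ) (θ φ : ℝ) :
    sphY ℓ m s θ φ = (wigY ℓ m s θ : ℂ) * Complex.exp (Complex.I * m * φ) := by
  by_cases hs : |s| ≤ ℓ
  swap
  · have h1 : ℓ < max m.natAbs s.natAbs := by
      rw [not_le, lt_abs] at hs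
      rw [lt_max_iff]
      omega
    simp [sphY, wigY, h1, hs]
  have h1 : ¬ ℓ < max m.natAbs s.natAbs := by
    rw [abs_le] at hs hm
    rw [lt_max_iff]
    omega
  have hfm := factorial_natAbs hm
  have hfs := factorial_natAbs hs
  simp only [sphY, wigY, h1, hs, if_true, if_false]
  congr 2
  have hs' := abs_le.1 hs
  have hm' := abs_le.1 hm
  have hD : (0 : ℝ) ≤ 2 * ℓ + 1 := by positivity
  have hpos : ∀ a b : ℕ, (0 : ℝ) < (a.factorial : ℝ) * b.factorial := fun a b => by positivity
  have hsign : ∀ a : ℕ, (a : ℤ) = m + s → (-1 : ℝ) ^ s * (-1) ^ a = (-1) ^ m := by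
    intro a h
    rw [← zpow_natCast, h, ← zpow_add₀ (by norm_num), show s + (m + s) = m + 2 * s by ring,
      zpow_add₀ (by norm_num), (even_two_mul s).neg_one_zpow, mul_one]
  rcases le_total s.natAbs m.natAbs with hc | hc
  · rw [max_eq_left hc, min_eq_right hc, mul_assoc (2 * (ℓ : ℝ) + 1), mul_assoc (2 : ℝ) (Nat.cast _),
      hfm, hfs]
    rcases le_total 0 m with h0 | h0
    · have e := wigC_top (ℓ - m.natAbs) (m + s).natAbs (m - s).natAbs θ
      rw [show ℓ - m.natAbs + (m - s).natAbs = ((ℓ : ℤ) - s).toNat by omega,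
        show ℓ - m.natAbs + (m + s).natAbs = ((ℓ : ℤ) + s).toNat by omega] at e
      nth_rewrite 1 [show ℓ - m.natAbs = ((ℓ : ℤ) - m).toNat by omega] at e
      rw [e, max_eq_left (by omega), ← hsign (m + s).natAbs (by omega)]
      ring
    · have e := wigC_bot (ℓ - m.natAbs) (m + s).natAbs (m - s).natAbs θ
      rw [show ℓ - m.natAbs + (m + s).natAbs + (m - s).natAbs = ((ℓ : ℤ) - m).toNat by omega,
        show ℓ - m.natAbs + (m - s).natAbs = ((ℓ : ℤ) + s).toNat by omega,
        show ℓ - m.natAbs + (m + s).natAbs = ((ℓ : ℤ) - s).toNat by omega] at e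
      rw [e, max_eq_right (by omega), zpow_neg, ← inv_zpow, inv_neg_one]
      ring
  · rw [max_eq_right hc, min_eq_left hc, mul_assoc (2 * (ℓ : ℝ) + 1), mul_assoc (2 : ℝ) (Nat.cast _),
      hfm, hfs]
    rcases le_total 0 s with h0 | h0
    · rw [show ℓ - s.natAbs = ((ℓ : ℤ) - s).toNat by omega]
      have e := wigC_left ((ℓ : ℤ) - s).toNat (m + s).natAbs (m - s).natAbs θ
      rw [show ((ℓ : ℤ) - s).toNat + (m + s).natAbs + (m - s).natAbs = ((ℓ : ℤ) + s).toNat by omega,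
        show ((ℓ : ℤ) - s).toNat + (m - s).natAbs = ((ℓ : ℤ) - m).toNat by omega,
        show ((ℓ : ℤ) - s).toNat + (m + s).natAbs = ((ℓ : ℤ) + m).toNat by omega] at e
      have e' := sqrt_ratio_mul hD (hpos _ _) (hpos _ _) e
      rw [mul_assoc ((-1 : ℝ) ^ s), ← e', max_eq_left (by omega),
        ← hsign (m + s).natAbs (by omega)]
      ring
    · rw [show ℓ - s.natAbs = ((ℓ : ℤ) + s).toNat by omega]
      have e := wigC_right ((ℓ : ℤ) + s).toNat (m + s).natAbs (m - s).natAbs θ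
      rw [show ((ℓ : ℤ) + s).toNat + (m + s).natAbs + (m - s).natAbs = ((ℓ : ℤ) - s).toNat by omega,
        show ((ℓ : ℤ) + s).toNat + (m - s).natAbs = ((ℓ : ℤ) + m).toNat by omega,
        show ((ℓ : ℤ) + s).toNat + (m + s).natAbs = ((ℓ : ℤ) - m).toNat by omega,
        mul_comm (((ℓ : ℤ) - m).toNat.factorial : ℝ),
        mul_comm (((ℓ : ℤ) - s).toNat.factorial : ℝ)] at e
      have e' := sqrt_ratio_mul hD (hpos _ _) (hpos _ _) e
      rw [mul_assoc ((-1 : ℝ) ^ s), ← e', max_eq_right (by omega), zpow_neg, ← inv_zpow,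
        inv_neg_one]
      ring

/-- A step from outside the ladder into it starts at s = ±(ℓ+1), where the radicand of the
wavenumber is 0. This extends the ladder relations to all spins. -/
theorem kNum_mul_wigY_eq_zero {ℓ : ℕ} {s : ℤ} (hs : (ℓ : ℤ) < |s|) (m : ℤ) (σ : SignType) (θ : ℝ) :
    kNum ℓ s σ * wigY ℓ m (s + σ) θ = 0 := by
  by_cases h : |s + σ| ≤ ℓ
  · have : kNum ℓ s σ = 0 := by
      rw [lt_abs] at hs
      rw [abs_le] at h
      cases σ
      · simp [kNum]
      · simp only [SignType.neg_eq_neg_one, SignType.coe_neg, SignType.coe_one] at h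
        have : s = ℓ + 1 := by omega
        subst this
        simp [kNum]
      · simp only [SignType.pos_eq_one, SignType.coe_one] at h
        have : s = -ℓ - 1 := by omega
        subst this
        simp [kNum, show (ℓ : ℝ) + (-ℓ - 1) + 1 = 0 by ring]
    rw [this, zero_mul]
  · simp [wigY, h]

theorem sqrt_div_factorial_mul {X : ℝ} (P q : ℕ) :
    √(X / (2 * ((q.factorial : ℝ) * (P + 1).factorial))) * (P + 1)
      = √(X / (2 * ((q + 1).factorial * P.factorial))) * √((P + 1) * (q + 1)) := by
  have h1 : ((P : ℝ) + 1) = √(((P : ℝ) + 1) ^ 2) := (Real.sqrt_sq (by positivity)).symm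
  have h2 : (0 : ℝ) ≤ ((P : ℝ) + 1) * (q + 1) := by positivity
  conv_lhs => rw [h1]
  rw [← Real.sqrt_mul' _ (by positivity), ← Real.sqrt_mul' _ h2]
  congr 1
  rw [Nat.factorial_succ, Nat.factorial_succ]
  push_cast
  field_simp

/-- The wavenumber is the ratio of the normalisations at neighbouring spins, up to the factor ℓ - s;
the sign comes from (-1)^s. -/
theorem kNum_pos_mul_wigY {ℓ : ℕ} {s : ℤ} (hs : |s| ≤ ℓ) (m : ℤ) (θ : ℝ) :
    kNum ℓ s 1 * wigY ℓ m (s + 1) θ / √2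
      = (-1 : ℝ) ^ s * √((2 * (ℓ : ℝ) + 1)
          * (((ℓ : ℤ) + m).toNat.factorial * ((ℓ : ℤ) - m).toNat.factorial)
          / (2 * (((ℓ : ℤ) + s).toNat.factorial * ((ℓ : ℤ) - s).toNat.factorial)))
        * ((((ℓ : ℤ) - s).toNat : ℝ) / 2
          * wigC (((ℓ : ℤ) - s).toNat - 1) (((ℓ : ℤ) + s).toNat + 1) ((ℓ : ℤ) - m).toNat θ) := by
  have hs' := abs_le.1 hs
  by_cases h : s = ℓ
  · subst h
    simp [kNum]
  · have h1 : |s + 1| ≤ (ℓ : ℤ) := abs_le.2 (by omega)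
    obtain ⟨P, hP⟩ : ∃ P : ℕ, (ℓ : ℤ) - s = P + 1 := ⟨((ℓ : ℤ) - s - 1).toNat, by omega⟩
    obtain ⟨q, hq⟩ : ∃ q : ℕ, (ℓ : ℤ) + s = q := ⟨((ℓ : ℤ) + s).toNat, by omega⟩
    have hP' : (ℓ : ℝ) - s = P + 1 := by exact_mod_cast hP
    have hq' : (ℓ : ℝ) + s = q := by exact_mod_cast hq
    simp only [wigY, h1, if_true]
    rw [show ((ℓ : ℤ) - s).toNat = P + 1 by omega, show ((ℓ : ℤ) + s).toNat = q by omega,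
      show ((ℓ : ℤ) - (s + 1)).toNat = P by omega, show ((ℓ : ℤ) + (s + 1)).toNat = q + 1 by omega,
      add_tsub_cancel_right]
    have e := sqrt_div_factorial_mul (X := (2 * (ℓ : ℝ) + 1)
      * (((ℓ : ℤ) + m).toNat.factorial * ((ℓ : ℤ) - m).toNat.factorial)) P q
    have hk : kNum ℓ s 1 = -(√((P + 1) * (q + 1)) / √2) := by
      simp only [kNum, SignType.coe_one, one_mul]
      rw [hP', hq', Real.sqrt_div (by positivity)]
      ring
    have h2 : √2 * √2 = (2 : ℝ) := Real.mul_self_sqrt (by norm_num)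
    have h3 : (√2 : ℝ) ≠ 0 := by positivity
    rw [hk, zpow_add_one₀ (by norm_num)]
    push_cast
    generalize (2 * (ℓ : ℝ) + 1)
      * (((ℓ : ℤ) + m).toNat.factorial * ((ℓ : ℤ) - m).toNat.factorial) = X at *
    generalize √(X / (2 * ((q.factorial : ℝ) * (P + 1).factorial))) = U at *
    generalize √(X / (2 * (((q + 1).factorial : ℝ) * P.factorial))) = V at *
    generalize wigC P (q + 1) _ θ = c at *
    field_simp
    rw [pow_two, h2]
    linear_combination (-2 * c) * e

theorem kNum_neg_mul_wigY {ℓ : ℕ} {s : ℤ} (hs : |s| ≤ ℓ) (m : ℤ) (θ : ℝ) :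
    kNum ℓ s (-1) * wigY ℓ m (s - 1) θ / √2
      = -((-1 : ℝ) ^ s * √((2 * (ℓ : ℝ) + 1)
          * (((ℓ : ℤ) + m).toNat.factorial * ((ℓ : ℤ) - m).toNat.factorial)
          / (2 * (((ℓ : ℤ) + s).toNat.factorial * ((ℓ : ℤ) - s).toNat.factorial)))
        * ((((ℓ : ℤ) + s).toNat : ℝ) / 2
          * wigC (((ℓ : ℤ) - s).toNat + 1) (((ℓ : ℤ) + s).toNat - 1) ((ℓ : ℤ) - m).toNat θ)) := by
  have hs' := abs_le.1 hs
  by_cases h : s = -ℓ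
  · subst h
    simp [kNum]
  · have h1 : |s - 1| ≤ (ℓ : ℤ) := abs_le.2 (by omega)
    obtain ⟨Q, hQ⟩ : ∃ Q : ℕ, (ℓ : ℤ) + s = Q + 1 := ⟨((ℓ : ℤ) + s - 1).toNat, by omega⟩
    obtain ⟨p, hp⟩ : ∃ p : ℕ, (ℓ : ℤ) - s = p := ⟨((ℓ : ℤ) - s).toNat, by omega⟩
    have hQ' : (ℓ : ℝ) + s = Q + 1 := by exact_mod_cast hQ
    have hp' : (ℓ : ℝ) - s = p := by exact_mod_cast hp
    simp only [wigY, h1, if_true]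
    rw [show ((ℓ : ℤ) + s).toNat = Q + 1 by omega, show ((ℓ : ℤ) - s).toNat = p by omega,
      show ((ℓ : ℤ) + (s - 1)).toNat = Q by omega, show ((ℓ : ℤ) - (s - 1)).toNat = p + 1 by omega,
      add_tsub_cancel_right]
    have e := sqrt_div_factorial_mul (X := (2 * (ℓ : ℝ) + 1)
      * (((ℓ : ℤ) + m).toNat.factorial * ((ℓ : ℤ) - m).toNat.factorial)) Q p
    rw [mul_comm (p.factorial : ℝ), mul_comm ((p + 1).factorial : ℝ)] at e
    have hk : kNum ℓ s (-1) = √((Q + 1) * (p + 1)) / √2 := by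
      simp only [kNum, SignType.coe_neg, SignType.coe_one]
      rw [show ((ℓ : ℝ) - -1 * s) = Q + 1 by linarith, show (ℓ : ℝ) + -1 * s + 1 = p + 1 by linarith,
        Real.sqrt_div (by positivity)]
      ring
    have h2 : √2 * √2 = (2 : ℝ) := Real.mul_self_sqrt (by norm_num)
    have h3 : (√2 : ℝ) ≠ 0 := by positivity
    rw [hk, zpow_sub_one₀ (by norm_num), inv_neg_one]
    push_cast
    generalize (2 * (ℓ : ℝ) + 1)
      * (((ℓ : ℤ) + m).toNat.factorial * ((ℓ : ℤ) - m).toNat.factorial) = X at *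
    generalize √(X / (2 * (((Q + 1).factorial : ℝ) * p.factorial))) = U at *
    generalize √(X / (2 * ((Q.factorial : ℝ) * (p + 1).factorial))) = V at *
    generalize wigC (p + 1) Q _ θ = c at *
    field_simp
    rw [pow_two, h2]
    linear_combination (2 * c) * e

theorem hasDerivAt_wigY (ℓ : ℕ) (m s : ℤ) (θ : ℝ) :
    HasDerivAt (wigY ℓ m s)
      ((kNum ℓ s 1 * wigY ℓ m (s + 1) θ + kNum ℓ s (-1) * wigY ℓ m (s - 1) θ) / √2) θ := by
  by_cases hs : |s| ≤ ℓ
  · have h := ((hasDerivAt_wigC ((ℓ : ℤ) - s).toNat ((ℓ : ℤ) + s).toNat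
      ((ℓ : ℤ) - m).toNat θ).const_mul ((-1 : ℝ) ^ s * √((2 * (ℓ : ℝ) + 1)
          * (((ℓ : ℤ) + m).toNat.factorial * ((ℓ : ℤ) - m).toNat.factorial)
          / (2 * (((ℓ : ℤ) + s).toNat.factorial * ((ℓ : ℤ) - s).toNat.factorial)))))
    have e : wigY ℓ m s = fun θ => (-1 : ℝ) ^ s * √((2 * (ℓ : ℝ) + 1)
          * (((ℓ : ℤ) + m).toNat.factorial * ((ℓ : ℤ) - m).toNat.factorial)
          / (2 * (((ℓ : ℤ) + s).toNat.factorial * ((ℓ : ℤ) - s).toNat.factorial)))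
          * wigC ((ℓ : ℤ) - s).toNat ((ℓ : ℤ) + s).toNat ((ℓ : ℤ) - m).toNat θ := by
      ext θ
      simp [wigY, hs]
    rw [e]
    refine h.congr_deriv ?_
    rw [add_div, kNum_pos_mul_wigY hs, kNum_neg_mul_wigY hs]
    ring
  · have e : wigY ℓ m s = fun _ => 0 := by
      ext θ
      simp [wigY, hs]
    have h1 := kNum_mul_wigY_eq_zero (not_le.1 hs) m 1 θ
    have h2 := kNum_mul_wigY_eq_zero (not_le.1 hs) m (-1) θ
    rw [SignType.coe_one] at h1
    rw [SignType.coe_neg, SignType.coe_one, ← sub_eq_add_neg] at h2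
    rw [h1, h2, e]
    simpa using hasDerivAt_const θ (0 : ℝ)

/-- `wigC_euler` with p = ℓ-s, q = ℓ+s, i = ℓ-m: the weight p+q-2i is 2m and p-q is -2s. -/
theorem wigY_euler {ℓ : ℕ} {m : ℤ} (hm : |m| ≤ ℓ) (s : ℤ) (θ : ℝ) :
    ((m : ℝ) + s * Real.cos θ) * wigY ℓ m s θ
      = -(Real.sin θ * ((kNum ℓ s 1 * wigY ℓ m (s + 1) θ
          - kNum ℓ s (-1) * wigY ℓ m (s - 1) θ) / √2)) := by
  by_cases hs : |s| ≤ ℓ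
  · rw [sub_div, kNum_pos_mul_wigY hs, kNum_neg_mul_wigY hs]
    have e := wigC_euler ((ℓ : ℤ) - s).toNat ((ℓ : ℤ) + s).toNat ((ℓ : ℤ) - m).toNat θ
    rw [abs_le] at hs hm
    have h1 : (((ℓ : ℤ) - s).toNat : ℝ) = ℓ - s := by
      have : (((ℓ : ℤ) - s).toNat : ℤ) = ℓ - s := by omega
      exact_mod_cast this
    have h2 : (((ℓ : ℤ) + s).toNat : ℝ) = ℓ + s := by
      have : (((ℓ : ℤ) + s).toNat : ℤ) = ℓ + s := by omega
      exact_mod_cast this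
    have h3 : (((ℓ : ℤ) - m).toNat : ℝ) = ℓ - m := by
      have : (((ℓ : ℤ) - m).toNat : ℤ) = ℓ - m := by omega
      exact_mod_cast this
    rw [h1, h2, h3] at e
    rw [h1, h2]
    simp only [wigY, abs_le.2 hs, if_true]
    linear_combination ((-1 : ℝ) ^ s * √((2 * (ℓ : ℝ) + 1)
          * (((ℓ : ℤ) + m).toNat.factorial * ((ℓ : ℤ) - m).toNat.factorial)
          / (2 * (((ℓ : ℤ) + s).toNat.factorial * ((ℓ : ℤ) - s).toNat.factorial))) / 2) * e
  · have h1 := kNum_mul_wigY_eq_zero (not_le.1 hs) m 1 θ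
    have h2 := kNum_mul_wigY_eq_zero (not_le.1 hs) m (-1) θ
    rw [SignType.coe_one] at h1
    rw [SignType.coe_neg, SignType.coe_one, ← sub_eq_add_neg] at h2
    rw [h1, h2]
    simp [wigY, hs]

end BallTensor
end

/-! ### Smoothness and angular derivatives of the frame and of its tensor products. -/

open scoped BigOperators
noncomputable section
namespace BallTensor

theorem contDiff_ofReal_comp {f : ℝ × ℝ × ℝ → ℝ} {n : WithTop ℕ∞} (hf : ContDiff ℝ n f) :
    ContDiff ℝ n fun p => (f p : ℂ) :=
  Complex.ofRealCLM.contDiff.comp hf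

theorem contDiff_eR (k : Fin 3) {n : WithTop ℕ∞} : ContDiff ℝ n fun p => eR p k := by
  fin_cases k <;> exact contDiff_ofReal_comp (by fun_prop)

theorem contDiff_eTheta (k : Fin 3) {n : WithTop ℕ∞} : ContDiff ℝ n fun p => eTheta p k := by
  fin_cases k <;> exact contDiff_ofReal_comp (by fun_prop)

theorem contDiff_ePhi (k : Fin 3) {n : WithTop ℕ∞} : ContDiff ℝ n fun p => ePhi p k := by
  fin_cases k
  · exact contDiff_ofReal_comp (f := fun p => -Real.sin p.2.2) (by fun_prop)
  · exact contDiff_ofReal_comp (f := fun p => Real.cos p.2.2) (by fun_prop)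
  · exact contDiff_const

theorem contDiff_spinE (σ : SignType) (k : Fin 3) {n : WithTop ℕ∞} :
    ContDiff ℝ n fun p => spinE σ p k := by
  cases σ
  · exact contDiff_eR k
  · exact contDiff_const.mul ((contDiff_eTheta k).add (contDiff_const.mul (contDiff_ePhi k)))
  · exact contDiff_const.mul ((contDiff_eTheta k).sub (contDiff_const.mul (contDiff_ePhi k)))

theorem contDiff_tensE_apply {n : ℕ} (σ : MIdx n) (K : Fin n → Fin 3) {k : WithTop ℕ∞} :
    ContDiff ℝ k fun p => tensE σ p K :=
  contDiff_prod fun i _ => contDiff_spinE (σ i) (K i)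

theorem contDiff_tensE {n : ℕ} (σ : MIdx n) {k : WithTop ℕ∞} :
    ContDiff ℝ k (tensE σ) :=
  contDiff_pi.2 fun K => contDiff_tensE_apply σ K

section partials
variable {V : Type*} [NormedAddCommGroup V] [NormedSpace ℝ V] {F : ℝ × ℝ × ℝ → V} {F' : V}
  {r θ φ : ℝ}

theorem fderiv_apply_radius (h : DifferentiableAt ℝ F (r, θ, φ))
    (h' : HasDerivAt (fun t => F (t, θ, φ)) F' r) : fderiv ℝ F (r, θ, φ) (1, 0, 0) = F' := by
  have hc : HasDerivAt (fun t : ℝ => (t, θ, φ)) (1, 0, 0) r :=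
    (hasDerivAt_id r).prodMk ((hasDerivAt_const r θ).prodMk (hasDerivAt_const r φ))
  exact (h.hasFDerivAt.comp_hasDerivAt r hc).unique h'

theorem fderiv_apply_colatitude (h : DifferentiableAt ℝ F (r, θ, φ))
    (h' : HasDerivAt (fun t => F (r, t, φ)) F' θ) : fderiv ℝ F (r, θ, φ) (0, 1, 0) = F' := by
  have hc : HasDerivAt (fun t : ℝ => (r, t, φ)) (0, 1, 0) θ :=
    (hasDerivAt_const θ r).prodMk ((hasDerivAt_id θ).prodMk (hasDerivAt_const θ φ))
  exact (h.hasFDerivAt.comp_hasDerivAt θ hc).unique h'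

theorem fderiv_apply_longitude (h : DifferentiableAt ℝ F (r, θ, φ))
    (h' : HasDerivAt (fun t => F (r, θ, t)) F' φ) : fderiv ℝ F (r, θ, φ) (0, 0, 1) = F' := by
  have hc : HasDerivAt (fun t : ℝ => (r, θ, t)) (0, 0, 1) φ :=
    (hasDerivAt_const φ r).prodMk ((hasDerivAt_const φ θ).prodMk (hasDerivAt_id φ))
  exact (h.hasFDerivAt.comp_hasDerivAt φ hc).unique h'

end partials

section frame
variable (r θ φ : ℝ) (k : Fin 3)

theorem hasDerivAt_eR_colatitude :
    HasDerivAt (fun t => eR (r, t, φ) k) (eTheta (r, θ, φ) k) θ := by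
  fin_cases k
  · exact ((Real.hasDerivAt_sin θ).mul_const (Real.cos φ)).ofReal_comp
  · exact ((Real.hasDerivAt_sin θ).mul_const (Real.sin φ)).ofReal_comp
  · exact (Real.hasDerivAt_cos θ).ofReal_comp

theorem hasDerivAt_eTheta_colatitude :
    HasDerivAt (fun t => eTheta (r, t, φ) k) (-eR (r, θ, φ) k) θ := by
  fin_cases k
  · refine ((Real.hasDerivAt_cos θ).mul_const (Real.cos φ)).ofReal_comp.congr_deriv ?_
    simp [eR]
  · refine ((Real.hasDerivAt_cos θ).mul_const (Real.sin φ)).ofReal_comp.congr_deriv ?_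
    simp [eR]
  · refine (Real.hasDerivAt_sin θ).neg.ofReal_comp.congr_deriv ?_
    simp [eR]

theorem hasDerivAt_ePhi_colatitude :
    HasDerivAt (fun t => ePhi (r, t, φ) k) 0 θ := hasDerivAt_const θ (ePhi (r, θ, φ) k)

theorem hasDerivAt_eR_longitude :
    HasDerivAt (fun t => eR (r, θ, t) k) ((Real.sin θ : ℂ) * ePhi (r, θ, φ) k) φ := by
  fin_cases k
  · refine ((Real.hasDerivAt_cos φ).const_mul (Real.sin θ)).ofReal_comp.congr_deriv ?_
    simp [ePhi]
  · refine ((Real.hasDerivAt_sin φ).const_mul (Real.sin θ)).ofReal_comp.congr_deriv ?_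
    simp [ePhi]
  · refine (hasDerivAt_const φ ((Real.cos θ : ℝ) : ℂ)).congr_deriv ?_
    simp [ePhi]

theorem hasDerivAt_eTheta_longitude :
    HasDerivAt (fun t => eTheta (r, θ, t) k) ((Real.cos θ : ℂ) * ePhi (r, θ, φ) k) φ := by
  fin_cases k
  · refine ((Real.hasDerivAt_cos φ).const_mul (Real.cos θ)).ofReal_comp.congr_deriv ?_
    simp [ePhi]
  · refine ((Real.hasDerivAt_sin φ).const_mul (Real.cos θ)).ofReal_comp.congr_deriv ?_
    simp [ePhi]
  · refine (hasDerivAt_const φ ((-Real.sin θ : ℝ) : ℂ)).congr_deriv ?_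
    simp [ePhi]

theorem hasDerivAt_ePhi_longitude :
    HasDerivAt (fun t => ePhi (r, θ, t) k)
      (-(Real.sin θ : ℂ) * eR (r, θ, φ) k - (Real.cos θ : ℂ) * eTheta (r, θ, φ) k) φ := by
  have h : ((Real.sin θ : ℂ)) ^ 2 + (Real.cos θ : ℂ) ^ 2 = 1 := by
    exact_mod_cast Real.sin_sq_add_cos_sq θ
  fin_cases k
  · refine (Real.hasDerivAt_sin φ).neg.ofReal_comp.congr_deriv ?_
    simp only [eR, eTheta, Fin.zero_eta, Matrix.cons_val_zero]
    push_cast at h ⊢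
    linear_combination (Complex.cos φ) * h
  · refine (Real.hasDerivAt_cos φ).ofReal_comp.congr_deriv ?_
    simp only [eR, eTheta, Fin.mk_one, Matrix.cons_val_one, Matrix.cons_val_zero]
    push_cast at h ⊢
    linear_combination (Complex.sin φ) * h
  · refine (hasDerivAt_const φ (0 : ℂ)).congr_deriv ?_
    simp [eR, eTheta]
    ring

theorem hasDerivAt_spinE_colatitude (ρ : SignType) :
    HasDerivAt (fun t => spinE ρ (r, t, φ) k)
      (-(1 / 2 : ℂ) * ∑ ρ', ((genJ 1 ρ ρ' - genJ (-1) ρ ρ' : ℝ) : ℂ) * spinE ρ' (r, θ, φ) k) θ := by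
  have hR := hasDerivAt_eR_colatitude r θ φ k
  have hT := hasDerivAt_eTheta_colatitude r θ φ k
  have hP := hasDerivAt_ePhi_colatitude r θ φ k
  have h2 : ((√2 : ℝ) : ℂ) * ((√2 : ℝ) : ℂ) = 2 := by
    exact_mod_cast Real.mul_self_sqrt (by norm_num : (0 : ℝ) ≤ 2)
  have h3 : ((√2 : ℝ) : ℂ) ≠ 0 := fun h => by simp [h] at h2
  cases ρ
  · refine hR.congr_deriv ?_
    simp [sum_signType, genJ, spinE]
    field_simp
    ring
  · refine ((hT.add (hP.const_mul Complex.I)).const_mul ((√2 : ℝ) : ℂ)⁻¹).congr_deriv ?_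
    simp [sum_signType, genJ, spinE]
    field_simp
    linear_combination (-eR (r, θ, φ) k) * h2
  · refine ((hT.sub (hP.const_mul Complex.I)).const_mul ((√2 : ℝ) : ℂ)⁻¹).congr_deriv ?_
    simp [sum_signType, genJ, spinE]
    field_simp
    linear_combination (-eR (r, θ, φ) k) * h2

theorem hasDerivAt_spinE_longitude (ρ : SignType) :
    HasDerivAt (fun t => spinE ρ (r, θ, t) k)
      (Complex.I * (Real.sin θ : ℂ) / 2
          * ∑ ρ', ((genJ 1 ρ ρ' + genJ (-1) ρ ρ' : ℝ) : ℂ) * spinE ρ' (r, θ, φ) k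
        + Complex.I * (ρ : ℂ) * (Real.cos θ : ℂ) * spinE ρ (r, θ, φ) k) φ := by
  have hR := hasDerivAt_eR_longitude r θ φ k
  have hT := hasDerivAt_eTheta_longitude r θ φ k
  have hP := hasDerivAt_ePhi_longitude r θ φ k
  have h2 : ((√2 : ℝ) : ℂ) * ((√2 : ℝ) : ℂ) = 2 := by
    exact_mod_cast Real.mul_self_sqrt (by norm_num : (0 : ℝ) ≤ 2)
  have h3 : ((√2 : ℝ) : ℂ) ≠ 0 := fun h => by simp [h] at h2
  cases ρ
  · refine hR.congr_deriv ?_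
    simp [sum_signType, genJ, spinE]
    field_simp
    linear_combination (2 * Complex.sin θ * ePhi (r, θ, φ) k) * Complex.I_sq
  · refine ((hT.add (hP.const_mul Complex.I)).const_mul ((√2 : ℝ) : ℂ)⁻¹).congr_deriv ?_
    simp [sum_signType, genJ, spinE]
    field_simp
    linear_combination (2 * Complex.cos θ * ePhi (r, θ, φ) k) * Complex.I_sq + (Complex.I * Complex.sin θ * eR (r, θ, φ) k) * h2
  · refine ((hT.sub (hP.const_mul Complex.I)).const_mul ((√2 : ℝ) : ℂ)⁻¹).congr_deriv ?_
    simp [sum_signType, genJ, spinE]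
    field_simp
    linear_combination (2 * Complex.cos θ * ePhi (r, θ, φ) k) * Complex.I_sq - (Complex.I * Complex.sin θ * eR (r, θ, φ) k) * h2

end frame
theorem tensE_cons {n : ℕ} (ρ : SignType) (τ : MIdx n) (p : ℝ × ℝ × ℝ) (K : Fin (n + 1) → Fin 3) :
    tensE (Fin.cons ρ τ : MIdx (n + 1)) p K = spinE ρ p (K 0) * tensE τ p (Fin.tail K) := by
  simp [tensE, Fin.prod_univ_succ, Fin.tail]

theorem sum_kronJ_cons {n : ℕ} (σ ρ : SignType) (τ : MIdx n) (u : SignType → ℂ)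
    (v : MIdx n → ℂ) :
    ∑ ρ', ∑ τ' : MIdx n, (kronJ σ (Fin.cons ρ' τ' : MIdx (n + 1)) (Fin.cons ρ τ) : ℂ)
        * (u ρ' * v τ')
      = (∑ ρ', (genJ σ ρ ρ' : ℂ) * u ρ') * v τ + u ρ * ∑ τ', (kronJ σ τ' τ : ℂ) * v τ' := by
  have h1 : ∑ ρ', ∑ τ' : MIdx n, ((if τ' = τ then genJ σ ρ ρ' else 0 : ℝ) : ℂ) * (u ρ' * v τ')
      = (∑ ρ', (genJ σ ρ ρ' : ℂ) * u ρ') * v τ := by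
    simp only [apply_ite Complex.ofReal, Complex.ofReal_zero, ite_mul, zero_mul,
      Finset.sum_ite_eq', Finset.mem_univ, if_true, Finset.sum_mul, mul_assoc]
  have h2 : ∑ ρ', ∑ τ' : MIdx n, ((if ρ' = ρ then kronJ σ τ' τ else 0 : ℝ) : ℂ) * (u ρ' * v τ')
      = u ρ * ∑ τ', (kronJ σ τ' τ : ℂ) * v τ' := by
    rw [Finset.sum_comm]
    simp only [apply_ite Complex.ofReal, Complex.ofReal_zero, ite_mul, zero_mul,
      Finset.sum_ite_eq', Finset.mem_univ, if_true, Finset.mul_sum, mul_left_comm (u ρ)]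
  simp only [kronJ_cons, Complex.ofReal_add, add_mul, Finset.sum_add_distrib]
  rw [h1, h2]

/-- The Leibniz rule over the slots turns the generators acting on one frame vector into their
Kronecker sum; `sum_kronJ_cons` is the inductive step. -/
theorem hasDerivAt_tensE_colatitude (r θ φ : ℝ) : ∀ {n : ℕ} (τ : MIdx n) (K : Fin n → Fin 3),
    HasDerivAt (fun t => tensE τ (r, t, φ) K)
      (-(1 / 2 : ℂ) * ∑ τ', ((kronJ 1 τ' τ - kronJ (-1) τ' τ : ℝ) : ℂ) * tensE τ' (r, θ, φ) K) θ
  | 0, τ, K => by simpa [tensE, kronJ] using hasDerivAt_const θ (1 : ℂ)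
  | n + 1, τ, K => by
    rw [← Fin.cons_self_tail τ]
    simp only [tensE_cons, sum_mIdx_succ]
    refine ((hasDerivAt_spinE_colatitude r θ φ (K 0) (τ 0)).mul
      (hasDerivAt_tensE_colatitude r θ φ (Fin.tail τ) (Fin.tail K))).congr_deriv ?_
    have h := fun σ => sum_kronJ_cons σ (τ 0) (Fin.tail τ)
      (fun ρ => spinE ρ (r, θ, φ) (K 0)) (fun τ => tensE τ (r, θ, φ) (Fin.tail K))
    simp only [Complex.ofReal_sub, sub_mul, Finset.sum_sub_distrib, h]
    ring

theorem hasDerivAt_tensE_longitude (r θ φ : ℝ) : ∀ {n : ℕ} (τ : MIdx n) (K : Fin n → Fin 3),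
    HasDerivAt (fun t => tensE τ (r, θ, t) K)
      (Complex.I * (Real.sin θ : ℂ) / 2
          * ∑ τ', ((kronJ 1 τ' τ + kronJ (-1) τ' τ : ℝ) : ℂ) * tensE τ' (r, θ, φ) K
        + Complex.I * (wt τ : ℂ) * (Real.cos θ : ℂ) * tensE τ (r, θ, φ) K) φ
  | 0, τ, K => by simpa [tensE, kronJ, wt] using hasDerivAt_const φ (1 : ℂ)
  | n + 1, τ, K => by
    rw [← Fin.cons_self_tail τ]
    simp only [tensE_cons, sum_mIdx_succ, wt_cons]
    refine ((hasDerivAt_spinE_longitude r θ φ (K 0) (τ 0)).mul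
      (hasDerivAt_tensE_longitude r θ φ (Fin.tail τ) (Fin.tail K))).congr_deriv ?_
    have h := fun σ => sum_kronJ_cons σ (τ 0) (Fin.tail τ)
      (fun ρ => spinE ρ (r, θ, φ) (K 0)) (fun τ => tensE τ (r, θ, φ) (Fin.tail K))
    simp only [Complex.ofReal_add, add_mul, Finset.sum_add_distrib, h]
    push_cast
    ring

end BallTensor
end

/-! ### The gradient in spin components, and spin raising and lowering of harmonics. -/

open scoped BigOperators
noncomputable section
namespace BallTensor

theorem sqrt_two_mul_self : ((√2 : ℝ) : ℂ) * ((√2 : ℝ) : ℂ) = 2 := by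
  exact_mod_cast Real.mul_self_sqrt (by norm_num : (0 : ℝ) ≤ 2)

theorem sqrt_two_ne_zero : ((√2 : ℝ) : ℂ) ≠ 0 := fun h => by simpa [h] using sqrt_two_mul_self

theorem fderiv_apply_tensor {n : ℕ} {T : ℝ × ℝ × ℝ → Tensor n} {p : ℝ × ℝ × ℝ}
    (h : DifferentiableAt ℝ T p) (v : ℝ × ℝ × ℝ) (K : Fin n → Fin 3) :
    fderiv ℝ T p v K = fderiv ℝ (fun p => T p K) p v := by
  rw [fderiv_pi fun K => differentiableAt_pi.1 h K]
  rfl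

theorem sum_smul_tensE_apply {n : ℕ} (f : MIdx n → ℝ × ℝ × ℝ → ℂ) (p : ℝ × ℝ × ℝ)
    (K : Fin n → Fin 3) :
    (∑ τ, f τ p • tensE τ p) K = ∑ τ, f τ p * tensE τ p K := by
  simp [Finset.sum_apply]

theorem differentiableAt_sum_smul_tensE {n : ℕ} {f : MIdx n → ℝ × ℝ × ℝ → ℂ} {p : ℝ × ℝ × ℝ}
    (hf : ∀ τ, DifferentiableAt ℝ (f τ) p) :
    DifferentiableAt ℝ (fun p => ∑ τ, f τ p • tensE τ p) p :=
  DifferentiableAt.fun_sum fun τ _ =>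
    (hf τ).smul ((contDiff_tensE τ (k := 1)).differentiable one_ne_zero p)

/-- The components in the spin basis of the gradient of the field with components `f`. -/
def gradComp {n : ℕ} (f : MIdx n → ℝ × ℝ × ℝ → ℂ) (p : ℝ × ℝ × ℝ) (σ : SignType) (τ : MIdx n) : ℂ :=
  if σ = 0 then fderiv ℝ (f τ) p (1, 0, 0)
  else (p.1 : ℂ)⁻¹ * ((fderiv ℝ (f τ) p (0, 1, 0)
      + (σ : ℂ) * Complex.I / (Real.sin p.2.1 : ℂ) * fderiv ℝ (f τ) p (0, 0, 1)
      - (σ : ℂ) * (wt τ : ℂ) * (Real.cos p.2.1 : ℂ) / (Real.sin p.2.1 : ℂ) * f τ p) / (√2 : ℝ)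
    - (σ : ℂ) / (√2 : ℝ) * ∑ τ', (kronJ σ τ τ' : ℂ) * f τ' p)

/-- The product rule separates derivatives of components from those of the frame. The latter are
linear in the frame, so reindexing makes them act on the components; e_θ and e_φ are then expressed
by e_±. -/
theorem tgrad_sum_smul_tensE {n : ℕ} {f : MIdx n → ℝ × ℝ × ℝ → ℂ} {p : ℝ × ℝ × ℝ}
    (hp : Real.sin p.2.1 ≠ 0) (hf : ∀ τ, DifferentiableAt ℝ (f τ) p) :
    tgrad (fun p => ∑ τ, f τ p • tensE τ p) p
      = ∑ σ : SignType, ∑ τ : MIdx n, gradComp f p σ τ • tensE (Fin.cons σ τ : MIdx (n + 1)) p := by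
  obtain ⟨r, θ, φ⟩ := p
  have hp' : Complex.sin θ ≠ 0 := by
    rw [← Complex.ofReal_sin]
    exact_mod_cast hp
  have hd := differentiableAt_sum_smul_tensE hf
  have hE : ∀ (τ : MIdx n) K, DifferentiableAt ℝ (fun p => tensE τ p K) (r, θ, φ) := fun τ K =>
    (contDiff_tensE_apply τ K (k := 1)).differentiable one_ne_zero _
  have hfd : ∀ v K, fderiv ℝ (fun p => ∑ τ, f τ p • tensE τ p) (r, θ, φ) v K
      = ∑ τ, (f τ (r, θ, φ) * fderiv ℝ (fun p => tensE τ p K) (r, θ, φ) v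
        + tensE τ (r, θ, φ) K * fderiv ℝ (f τ) (r, θ, φ) v) := by
    intro v K
    rw [fderiv_apply_tensor hd]
    simp only [sum_smul_tensE_apply]
    rw [fderiv_fun_sum fun τ _ => (hf τ).fun_mul (hE τ K), sum_apply]
    refine Finset.sum_congr rfl fun τ _ => ?_
    rw [fderiv_fun_mul (hf τ) (hE τ K)]
    simp
  have hr : ∀ (τ : MIdx n) K, fderiv ℝ (fun p => tensE τ p K) (r, θ, φ) (1, 0, 0) = 0 :=
    fun τ K => fderiv_apply_radius (hE τ K) (hasDerivAt_const r (tensE τ (r, θ, φ) K))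
  have hθ := fun (τ : MIdx n) K =>
    fderiv_apply_colatitude (hE τ K) (hasDerivAt_tensE_colatitude r θ φ τ K)
  have hφ := fun (τ : MIdx n) K =>
    fderiv_apply_longitude (hE τ K) (hasDerivAt_tensE_longitude r θ φ τ K)
  ext K
  have hT : eTheta (r, θ, φ) (K 0) = (spinE 1 (r, θ, φ) (K 0) + spinE (-1) (r, θ, φ) (K 0))
      / (√2 : ℝ) := by
    have e1 : spinE 1 (r, θ, φ) (K 0) = ((√2 : ℝ) : ℂ)⁻¹ * (eTheta (r, θ, φ) (K 0)
      - Complex.I * ePhi (r, θ, φ) (K 0)) := rfl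
    have e2 : spinE (-1) (r, θ, φ) (K 0) = ((√2 : ℝ) : ℂ)⁻¹ * (eTheta (r, θ, φ) (K 0)
      + Complex.I * ePhi (r, θ, φ) (K 0)) := rfl
    rw [e1, e2]
    have := sqrt_two_ne_zero
    field_simp
    linear_combination (eTheta (r, θ, φ) (K 0)) * sqrt_two_mul_self
  have hP : ePhi (r, θ, φ) (K 0) = Complex.I * (spinE 1 (r, θ, φ) (K 0)
      - spinE (-1) (r, θ, φ) (K 0)) / (√2 : ℝ) := by
    have e1 : spinE 1 (r, θ, φ) (K 0) = ((√2 : ℝ) : ℂ)⁻¹ * (eTheta (r, θ, φ) (K 0)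
      - Complex.I * ePhi (r, θ, φ) (K 0)) := rfl
    have e2 : spinE (-1) (r, θ, φ) (K 0) = ((√2 : ℝ) : ℂ)⁻¹ * (eTheta (r, θ, φ) (K 0)
      + Complex.I * ePhi (r, θ, φ) (K 0)) := rfl
    rw [e1, e2]
    have := sqrt_two_ne_zero
    field_simp
    linear_combination (ePhi (r, θ, φ) (K 0)) * sqrt_two_mul_self
      + 2 * (ePhi (r, θ, φ) (K 0)) * Complex.I_sq
  -- Moves the Kronecker sum from the frame to the components.
  have hsw : ∀ σ : SignType, ∑ τ : MIdx n, (∑ τ', (kronJ σ τ τ' : ℂ) * f τ' (r, θ, φ))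
        * tensE τ (r, θ, φ) (Fin.tail K)
      = ∑ τ : MIdx n, f τ (r, θ, φ)
        * ∑ τ', (kronJ σ τ' τ : ℂ) * tensE τ' (r, θ, φ) (Fin.tail K) := by
    intro σ
    simp only [Finset.sum_mul, Finset.mul_sum]
    rw [Finset.sum_comm]
    refine Finset.sum_congr rfl fun τ _ => Finset.sum_congr rfl fun τ' _ => ?_
    ring
  have hL : ∀ (σ : SignType), σ ≠ 0 → ∑ τ : MIdx n, gradComp f (r, θ, φ) σ τ
        * tensE τ (r, θ, φ) (Fin.tail K)
      = (r : ℂ)⁻¹ * ∑ τ : MIdx n, ((fderiv ℝ (f τ) (r, θ, φ) (0, 1, 0)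
      + (σ : ℂ) * Complex.I / (Real.sin θ : ℂ) * fderiv ℝ (f τ) (r, θ, φ) (0, 0, 1)
      - (σ : ℂ) * (wt τ : ℂ) * (Real.cos θ : ℂ) / (Real.sin θ : ℂ) * f τ (r, θ, φ)) / (√2 : ℝ)
        * tensE τ (r, θ, φ) (Fin.tail K)
      - (σ : ℂ) / (√2 : ℝ) * (f τ (r, θ, φ)
        * ∑ τ', (kronJ σ τ' τ : ℂ) * tensE τ' (r, θ, φ) (Fin.tail K))) := by
    intro σ hσ
    rw [Finset.sum_sub_distrib, ← Finset.mul_sum Finset.univ _ ((σ : ℂ) / (√2 : ℝ)), ← hsw,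
      Finset.mul_sum, ← Finset.sum_sub_distrib, Finset.mul_sum]
    refine Finset.sum_congr rfl fun τ _ => ?_
    simp only [gradComp, if_neg hσ]
    ring
  have h0 : ∑ τ : MIdx n, gradComp f (r, θ, φ) 0 τ * tensE τ (r, θ, φ) (Fin.tail K)
      = ∑ τ, fderiv ℝ (f τ) (r, θ, φ) (1, 0, 0) * tensE τ (r, θ, φ) (Fin.tail K) := by
    simp [gradComp]
  have hRHS : (∑ σ : SignType, ∑ τ : MIdx n,
        gradComp f (r, θ, φ) σ τ • tensE (Fin.cons σ τ : MIdx (n + 1)) (r, θ, φ)) K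
      = ∑ σ : SignType, spinE σ (r, θ, φ) (K 0) * ∑ τ : MIdx n, gradComp f (r, θ, φ) σ τ
        * tensE τ (r, θ, φ) (Fin.tail K) := by
    simp only [Finset.sum_apply, Pi.smul_apply, smul_eq_mul, tensE_cons, Finset.mul_sum,
      mul_left_comm]
  rw [hRHS, sum_signType, h0, hL 1 (by decide), hL (-1) (by decide)]
  simp only [tgrad, hfd, hr, hθ, hφ, hT, hP]
  change spinE 0 (r, θ, φ) (K 0) * _ + _ + _ = _
  simp only [Finset.mul_sum, ← Finset.sum_add_distrib]
  refine Finset.sum_congr rfl fun τ _ => ?_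
  simp only [← Finset.mul_sum, Complex.ofReal_sub, Complex.ofReal_add, sub_mul, add_mul,
    Finset.sum_sub_distrib, Finset.sum_add_distrib]
  generalize (∑ τ', (kronJ 1 τ' τ : ℂ) * tensE τ' (r, θ, φ) (Fin.tail K)) = J1
  generalize (∑ τ', (kronJ (-1) τ' τ : ℂ) * tensE τ' (r, θ, φ) (Fin.tail K)) = J2
  generalize fderiv ℝ (f τ) (r, θ, φ) (0, 1, 0) = f1
  generalize fderiv ℝ (f τ) (r, θ, φ) (0, 0, 1) = f2
  generalize f τ (r, θ, φ) = f0
  generalize spinE 1 (r, θ, φ) (K 0) = s1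
  generalize spinE (-1) (r, θ, φ) (K 0) = s2
  generalize tensE τ (r, θ, φ) (Fin.tail K) = E
  push_cast
  simp only [SignType.coe_one]
  rw [mul_inv]
  generalize (r : ℂ)⁻¹ = ri
  have h2 := sqrt_two_mul_self
  have h3 := sqrt_two_ne_zero
  generalize ((√2 : ℝ) : ℂ) = q at *
  field_simp
  linear_combination (f0 * ri * (s1 - s2) * (2 * wt τ * Complex.cos θ * E
    + Complex.sin θ * (J1 + J2))) * Complex.I_sq

section harmonics
variable {ℓ : ℕ} {m : ℤ}

theorem hasDerivAt_sphY_colatitude (hm : |m| ≤ ℓ) (s : ℤ) (θ φ : ℝ) :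
    HasDerivAt (fun t => sphY ℓ m s t φ)
      (((kNum ℓ s 1 : ℂ) * sphY ℓ m (s + 1) θ φ + (kNum ℓ s (-1) : ℂ) * sphY ℓ m (s - 1) θ φ)
        / (√2 : ℝ)) θ := by
  simp only [sphY_eq hm]
  refine ((hasDerivAt_wigY ℓ m s θ).ofReal_comp.mul_const _).congr_deriv ?_
  push_cast
  ring

theorem hasDerivAt_sphY_longitude (s : ℤ) (θ φ : ℝ) :
    HasDerivAt (fun t => sphY ℓ m s θ t) (Complex.I * m * sphY ℓ m s θ φ) φ := by
  by_cases h : ℓ < max m.natAbs s.natAbs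
  · simp only [sphY, h, if_true, mul_zero]
    exact hasDerivAt_const _ _
  · simp only [sphY, h, if_false]
    have h1 : HasDerivAt (fun t : ℝ => Complex.exp (Complex.I * m * t))
        (Complex.exp (Complex.I * m * φ) * (Complex.I * m * 1)) φ :=
      ((Complex.ofRealCLM.hasDerivAt (x := φ)).const_mul (Complex.I * m)).cexp
    refine (h1.const_mul _).congr_deriv ?_
    ring

theorem sphY_euler (hm : |m| ≤ ℓ) (s : ℤ) (θ φ : ℝ) :
    ((m : ℂ) + s * (Real.cos θ : ℂ)) * sphY ℓ m s θ φ
      = -((Real.sin θ : ℂ) * (((kNum ℓ s 1 : ℂ) * sphY ℓ m (s + 1) θ φ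
          - (kNum ℓ s (-1) : ℂ) * sphY ℓ m (s - 1) θ φ) / (√2 : ℝ))) := by
  simp only [sphY_eq hm]
  have h := congrArg Complex.ofReal (wigY_euler hm s θ)
  push_cast at h ⊢
  linear_combination (Complex.exp (Complex.I * m * φ)) * h

theorem contDiff_sphY (ℓ : ℕ) (m s : ℤ) {n : WithTop ℕ∞} :
    ContDiff ℝ n fun p : ℝ × ℝ × ℝ => sphY ℓ m s p.2.1 p.2.2 := by
  by_cases h : ℓ < max m.natAbs s.natAbs
  · simp only [sphY, h, if_true]
    exact contDiff_const
  · simp only [sphY, h, if_false]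
    refine (contDiff_ofReal_comp ?_).mul ?_
    · simp only [jacobiP]
      fun_prop
    · exact (contDiff_const.mul (contDiff_ofReal_comp (by fun_prop))).cexp

/-- The spin raising and lowering operators act on the harmonics. -/
theorem sphY_eth (hm : |m| ≤ ℓ) {σ : SignType} (hσ : σ ≠ 0) (s : ℤ) {θ : ℝ} (hθ : Real.sin θ ≠ 0)
    (φ : ℝ) :
    ((kNum ℓ s 1 : ℂ) * sphY ℓ m (s + 1) θ φ + (kNum ℓ s (-1) : ℂ) * sphY ℓ m (s - 1) θ φ)
          / (√2 : ℝ)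
        + (σ : ℂ) * Complex.I / (Real.sin θ : ℂ) * (Complex.I * m * sphY ℓ m s θ φ)
        - (σ : ℂ) * (s : ℂ) * (Real.cos θ : ℂ) / (Real.sin θ : ℂ) * sphY ℓ m s θ φ
      = (√2 : ℝ) * (kNum ℓ s σ * sphY ℓ m (σ + s) θ φ) := by
  have h := sphY_euler hm s θ φ
  have hθ' : (Real.sin θ : ℂ) ≠ 0 := by exact_mod_cast hθ
  have h2 := sqrt_two_mul_self
  have h3 := sqrt_two_ne_zero
  have e : (σ : ℂ) * Complex.I / (Real.sin θ : ℂ) * (Complex.I * m * sphY ℓ m s θ φ)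
        - (σ : ℂ) * (s : ℂ) * (Real.cos θ : ℂ) / (Real.sin θ : ℂ) * sphY ℓ m s θ φ
      = (σ : ℂ) * (((kNum ℓ s 1 : ℂ) * sphY ℓ m (s + 1) θ φ
          - (kNum ℓ s (-1) : ℂ) * sphY ℓ m (s - 1) θ φ) / (√2 : ℝ)) := by
    rw [eq_comm, ← mul_left_inj' hθ']
    generalize ((kNum ℓ s 1 : ℂ) * sphY ℓ m (s + 1) θ φ
          - (kNum ℓ s (-1) : ℂ) * sphY ℓ m (s - 1) θ φ) / (√2 : ℝ) = X at *
    field_simp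
    linear_combination (σ : ℂ) * h - (σ * m * sphY ℓ m s θ φ : ℂ) * Complex.I_sq
  rw [add_sub_assoc, e]
  generalize ((√2 : ℝ) : ℂ) = q at *
  cases σ
  · exact absurd rfl hσ
  · simp only [SignType.neg_eq_neg_one, SignType.coe_neg, SignType.coe_one]
    rw [show (-1 : ℤ) + s = s - 1 by ring]
    field_simp
    linear_combination (-(kNum ℓ s (-1) * sphY ℓ m (s - 1) θ φ : ℂ)) * h2
  · simp only [SignType.pos_eq_one, SignType.coe_one]
    rw [show (1 : ℤ) + s = s + 1 by ring]
    field_simp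
    linear_combination (-(kNum ℓ s 1 * sphY ℓ m (s + 1) θ φ : ℂ)) * h2

end harmonics

end BallTensor
end

/-! ### The gradient of a single mode. -/

open scoped BigOperators
noncomputable section
namespace BallTensor

theorem ofReal_signType (σ : SignType) : ((σ : ℝ) : ℂ) = (σ : ℂ) := by
  cases σ <;> simp

theorem inv_sqrt_mul_mul_sqrt_div {x y : ℝ} (hx : 0 < x) (hy : 0 < y) :
    (√(x * y))⁻¹ * √(x / y) = 1 / y := by
  have h1 : √x ≠ 0 := by positivity
  have h2 : √y ≠ 0 := by positivity
  rw [Real.sqrt_mul hx.le, Real.sqrt_div hx.le]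
  field_simp
  rw [Real.sq_sqrt hy.le]

/-- With u = A' and v = A/r, the bracket is D^a A. The products of the recursion coefficients with
ξ^± are (L+1)/(2L+1), L/(2L+1) and ±1/(2L+1), so that in the radial part the v-terms cancel, and in
the angular part the u-terms. -/
theorem sum_qMat_mul_xi {n ℓ : ℕ} (σ : SignType) (τ b : MIdx n) (u v : ℂ) :
    ∑ a : SignType, (qMat ℓ (n + 1) (Fin.cons σ τ) (Fin.cons a b) : ℂ)
        * ((xi a (ℓ + wt b) : ℂ) * (if a = 0 then 0 else if a = 1 then u - ((ℓ + wt b : ℤ) : ℂ) * v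
          else u + (((ℓ + wt b : ℤ) : ℂ) + 1) * v))
      = (if σ = 0 then (qMat ℓ n τ b : ℂ) * u else 0) - (rOp ℓ σ 0 (qCol ℓ b) τ : ℂ) * v := by
  by_cases hb : Admissible ℓ b
  swap
  · have h1 : ∀ a, ¬ Admissible ℓ (Fin.cons a b : MIdx (n + 1)) := fun a h => hb (by simpa using h.1)
    have h2 : ∀ a σ, qMat ℓ (n + 1) σ (Fin.cons a b : MIdx (n + 1)) = 0 :=
      fun a => congrFun (qCol_eq_zero (h1 a))
    have h3 : qMat ℓ n τ b = 0 := congrFun (qCol_eq_zero hb) τ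
    have h4 : rOp ℓ σ 0 (qCol ℓ b) τ = 0 := by simp [rOp, qCol_eq_zero hb]
    simp [h2, h3, h4]
  have h0 := hb.nonneg
  have key : ∀ a, qMat ℓ (n + 1) (Fin.cons σ τ) (Fin.cons a b)
      = (if σ = 0 then 1 else 0) * coefE a (ℓ + wt b) * qMat ℓ n τ b
        + coefR a σ (ℓ + wt b) * rOp ℓ σ 0 (qCol ℓ b) τ :=
    fun a => congrFun (slice_qCol (ℓ := ℓ) a b σ) τ
  -- At L = 0 the column `a = -1` is missing, and its share of the angular part must vanish; it does
  -- because the eigenvalue is 0.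
  have hR : (ℓ : ℤ) + wt b = 0 → rOp ℓ σ 0 (qCol ℓ b) τ = 0 := fun h => by
    have h' : (ℓ : ℝ) + wt b = 0 := by exact_mod_cast h
    rw [(isEigen_qCol b).rOp_eq_zero (by rw [h']; simp)]
    rfl
  have e1 : (ℓ : ℝ) + wt b = ((ℓ : ℤ) + wt b : ℤ) := by push_cast; ring
  rw [e1] at key
  simp only [key]
  generalize (ℓ : ℤ) + wt b = L at *
  generalize rOp ℓ σ 0 (qCol ℓ b) τ = R at *
  generalize qMat ℓ n τ b = Q at *
  have hL : (0 : ℝ) ≤ L := by exact_mod_cast h0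
  have hL1 : (0 : ℝ) < L + 1 := by linarith
  have hL2 : (0 : ℝ) < 2 * L + 1 := by linarith
  have hp : coefE 1 (L : ℝ) * xi 1 L = (L + 1) / (2 * L + 1) := by
    change ((L : ℝ) + 1) * (√((L + 1) * (2 * L + 1)))⁻¹ * √((L + 1) / (2 * L + 1)) = _
    rw [mul_assoc, inv_sqrt_mul_mul_sqrt_div hL1 hL2, mul_one_div]
  have hm : coefE (-1) (L : ℝ) * xi (-1) L = L / (2 * L + 1) := by
    change (L : ℝ) * (√(L * (2 * L + 1)))⁻¹ * √(L / (2 * L + 1)) = _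
    rcases hL.eq_or_lt with h | h
    · simp [← h]
    · rw [mul_assoc, inv_sqrt_mul_mul_sqrt_div h hL2, mul_one_div]
  have hp' : coefR 1 σ (L : ℝ) * xi 1 L = 1 / (2 * L + 1) :=
    inv_sqrt_mul_mul_sqrt_div hL1 hL2
  have hm' : coefR (-1) σ (L : ℝ) * xi (-1) L * R = -(1 / (2 * L + 1)) * R := by
    change -(√((L : ℝ) * (2 * L + 1)))⁻¹ * √(L / (2 * L + 1)) * R = _
    rcases hL.eq_or_lt with h | h
    · have h' : L = 0 := by exact_mod_cast h.symm
      simp [hR h']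
    · rw [neg_mul, inv_sqrt_mul_mul_sqrt_div h hL2]
  have hp := congrArg Complex.ofReal hp
  have hm := congrArg Complex.ofReal hm
  have hp' := congrArg Complex.ofReal hp'
  have hm' := congrArg Complex.ofReal hm'
  have hL2' : (2 * (L : ℂ) + 1) ≠ 0 := by exact_mod_cast hL2.ne'
  push_cast at hp hm hp' hm'
  have h0 : xi 0 L = 0 := rfl
  rw [sum_signType]
  simp only [show (-1 : SignType) ≠ 0 by decide, show (-1 : SignType) ≠ 1 by decide,
    show (1 : SignType) ≠ 0 by decide, if_true, if_false, h0]
  have e1 : (if σ = 0 then (Q : ℂ) * u else 0) = (if σ = 0 then 1 else 0) * (Q * u) := by simp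
  rw [e1]
  push_cast
  simp only [apply_ite Complex.ofReal, Complex.ofReal_one, Complex.ofReal_zero]
  generalize (if σ = 0 then (1 : ℂ) else 0) = d
  have e2 : d * (Q * u) - R * v = d * Q * ((L + 1) / (2 * L + 1)) * (u - L * v)
      + d * Q * (L / (2 * L + 1)) * (u + (L + 1) * v) + R * (1 / (2 * L + 1)) * (u - L * v)
      - (1 / (2 * L + 1)) * R * (u + (L + 1) * v) := by
    have ht : (2 * (L : ℂ) + 1) * (2 * (L : ℂ) + 1)⁻¹ = 1 := mul_inv_cancel₀ hL2'
    simp only [div_eq_mul_inv, one_mul]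
    linear_combination (-(d * Q * u - R * v)) * ht
  rw [e2]
  linear_combination (d * Q * (u - L * v)) * hp + (d * Q * (u + (L + 1) * v)) * hm
    + (R * (u - L * v)) * hp' + (u + (L + 1) * v) * hm'

/-- The components in the spin basis of a field in a single mode. -/
def modeComp {n : ℕ} (q : Mode) (A : MIdx n → ℝ → ℂ) (τ : MIdx n) (p : ℝ × ℝ × ℝ) : ℂ :=
  ∑ b, (qMat q.1.1 n τ b : ℂ) * A b p.1 * sphY q.1.1 q.1.2 (wt τ) p.2.1 p.2.2

theorem modeField_eq {n : ℕ} (q : Mode) (A : MIdx n → ℝ → ℂ) :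
    modeField q A = fun p => ∑ τ, modeComp q A τ p • tensE τ p := by
  ext1 p
  simp only [modeField, modeComp, Finset.sum_smul]
  exact Finset.sum_comm

theorem differentiableAt_modeComp {n : ℕ} (q : Mode) {A : MIdx n → ℝ → ℂ} {p : ℝ × ℝ × ℝ}
    (hA : ∀ a, DifferentiableAt ℝ (A a) p.1) (τ : MIdx n) :
    DifferentiableAt ℝ (modeComp q A τ) p := by
  refine DifferentiableAt.fun_sum fun b _ => ?_
  refine DifferentiableAt.mul ?_ ((contDiff_sphY _ _ _ (n := 1)).differentiable one_ne_zero p)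
  exact ((hA b).comp p differentiableAt_fst).const_mul _

/-- `sphY_eth` supplies the wavenumber term, and the frame supplies the generators; the selection
rule `kronJ_ne_zero` gives both the same harmonic, and together they form -R_σ/r. -/
theorem gradComp_modeComp {n : ℕ} (q : Mode) {A : MIdx n → ℝ → ℂ} {p : ℝ × ℝ × ℝ}
    (hp : Real.sin p.2.1 ≠ 0) (hA : ∀ a, DifferentiableAt ℝ (A a) p.1) (σ : SignType)
    (τ : MIdx n) :
    gradComp (modeComp q A) p σ τ
      = ∑ b, ((if σ = 0 then (qMat q.1.1 n τ b : ℂ) * deriv (A b) p.1 else 0)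
          - (rOp q.1.1 σ 0 (qCol q.1.1 b) τ : ℂ) * ((p.1 : ℂ)⁻¹ * A b p.1))
        * sphY q.1.1 q.1.2 (σ + wt τ) p.2.1 p.2.2 := by
  obtain ⟨r, θ, φ⟩ := p
  have hd := differentiableAt_modeComp q hA τ
  have hr := fderiv_apply_radius hd (HasDerivAt.fun_sum fun b _ =>
    (((hA b).hasDerivAt.const_mul (qMat q.1.1 n τ b : ℂ)).mul_const
      (sphY q.1.1 q.1.2 (wt τ) θ φ)))
  have hθ := fderiv_apply_colatitude hd (HasDerivAt.fun_sum fun b _ =>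
    ((hasDerivAt_sphY_colatitude q.2 (wt τ) θ φ).const_mul ((qMat q.1.1 n τ b : ℂ) * A b r)))
  have hφ := fderiv_apply_longitude hd (HasDerivAt.fun_sum fun b _ =>
    ((hasDerivAt_sphY_longitude (ℓ := q.1.1) (m := q.1.2) (wt τ) θ φ).const_mul ((qMat q.1.1 n τ b : ℂ) * A b r)))
  by_cases hσ : σ = 0
  · subst hσ
    simp only [gradComp, if_true, hr, rOp_zero_left]
    simp
  · simp only [gradComp, if_neg hσ, hθ, hφ]
    have hk : ∀ τ', (kronJ σ τ τ' : ℂ) * modeComp q A τ' (r, θ, φ)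
        = ∑ b, (kronJ σ τ τ' : ℂ) * (qMat q.1.1 n τ' b : ℂ) * A b r
          * sphY q.1.1 q.1.2 (σ + wt τ) θ φ := by
      intro τ'
      by_cases h : kronJ σ τ τ' = 0
      · simp [h]
      · rw [modeComp, kronJ_ne_zero h, add_comm, Finset.mul_sum]
        exact Finset.sum_congr rfl fun b _ => by ring
    simp only [hk]
    rw [Finset.sum_comm]
    simp only [modeComp, Finset.mul_sum, ← Finset.sum_add_distrib, ← Finset.sum_sub_distrib,
      Finset.sum_div]
    refine Finset.sum_congr rfl fun b _ => ?_
    have he := sphY_eth q.2 hσ (wt τ) hp φ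
    have h3 := sqrt_two_ne_zero
    have hs : (rOp q.1.1 σ 0 (qCol q.1.1 b) τ : ℂ) = -(kNum q.1.1 (wt τ) σ * qMat q.1.1 n τ b)
        + σ / (√2 : ℝ) * ∑ τ', (kronJ σ τ τ' : ℂ) * qMat q.1.1 n τ' b := by
      simp only [rOp, qCol, add_zero, ← ofReal_signType]
      push_cast
      ring
    rw [hs]
    have e1 : ∀ c : ℂ, ∑ τ', c * ((kronJ σ τ τ' : ℂ) * (qMat q.1.1 n τ' b : ℂ) * A b r
          * sphY q.1.1 q.1.2 (σ + wt τ) θ φ)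
        = c * (∑ τ', (kronJ σ τ τ' : ℂ) * qMat q.1.1 n τ' b) * A b r
          * sphY q.1.1 q.1.2 (σ + wt τ) θ φ := by
      intro c
      simp only [Finset.mul_sum, Finset.sum_mul, mul_assoc]
    rw [e1]
    generalize ∑ τ', (kronJ σ τ τ' : ℂ) * (qMat q.1.1 n τ' b : ℂ) = S
    generalize ((√2 : ℝ) : ℂ) = w at *
    have hw : w * w⁻¹ = 1 := mul_inv_cancel₀ h3
    simp only [zero_sub, div_eq_mul_inv] at he ⊢
    linear_combination ((r : ℂ)⁻¹ * w⁻¹ * qMat q.1.1 n τ b * A b r) * he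
      + ((r : ℂ)⁻¹ * qMat q.1.1 n τ b * A b r * kNum q.1.1 (wt τ) σ
        * sphY q.1.1 q.1.2 (σ + wt τ) θ φ) * hw

theorem tgrad_modeField {n : ℕ} (q : Mode) {A : MIdx n → ℝ → ℂ} {p : ℝ × ℝ × ℝ}
    (hp : Real.sin p.2.1 ≠ 0) (hA : ∀ a, DifferentiableAt ℝ (A a) p.1) :
    tgrad (modeField q A) p = modeField q (fun (c : MIdx (n + 1)) r =>
      (xi (c 0) (q.1.1 + wt (Fin.tail c)) : ℂ) * radD (c 0) (q.1.1 + wt (Fin.tail c))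
        (A (Fin.tail c)) r) p := by
  rw [modeField_eq, tgrad_sum_smul_tensE hp (differentiableAt_modeComp q hA), modeField_eq]
  simp only [sum_mIdx_succ]
  refine Finset.sum_congr rfl fun σ _ => Finset.sum_congr rfl fun τ _ => ?_
  congr 1
  rw [gradComp_modeComp q hp hA]
  simp only [modeComp, sum_mIdx_succ, Fin.cons_zero, Fin.tail_cons, wt_cons]
  rw [Finset.sum_comm]
  refine Finset.sum_congr rfl fun b _ => ?_
  rw [← sum_qMat_mul_xi, Finset.sum_mul]
  refine Finset.sum_congr rfl fun a _ => ?_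
  cases a
  · simp [radD]
  · simp [radD]
    refine Or.inl (Or.inl (Or.inl ?_))
    ring
  · simp [radD]
    refine Or.inl (Or.inl (Or.inl ?_))
    ring

end BallTensor
end

/-! ### Divergence and Laplacian of a single mode. -/

open scoped BigOperators
noncomputable section
namespace BallTensor

theorem sum_spinE_mul_spinE (σ ρ : SignType) (p : ℝ × ℝ × ℝ) :
    ∑ i, spinE σ p i * spinE ρ p i = if σ = -ρ then 1 else 0 := by
  obtain ⟨r, θ, φ⟩ := p
  have h1 : Complex.sin θ ^ 2 + Complex.cos θ ^ 2 = 1 := Complex.sin_sq_add_cos_sq θ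
  have h2 : Complex.sin φ ^ 2 + Complex.cos φ ^ 2 = 1 := Complex.sin_sq_add_cos_sq φ
  have h3 := sqrt_two_mul_self
  have h4 := sqrt_two_ne_zero
  have h5 : (((√2 : ℝ) : ℂ)⁻¹) ^ 2 = 1 / 2 := by
    rw [inv_pow, pow_two, h3, one_div]
  rw [Fin.sum_univ_three]
  have hI := Complex.I_sq
  generalize hq : (((√2 : ℝ) : ℂ)⁻¹) = q at *
  have hs : Complex.sin θ ^ 2 = 1 - Complex.cos θ ^ 2 := by linear_combination h1
  have ht : Complex.sin φ ^ 2 = 1 - Complex.cos φ ^ 2 := by linear_combination h2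
  cases σ <;> cases ρ <;> simp [spinE, eR, eTheta, ePhi, hq] <;> ring_nf <;>
    simp only [hI, h5, hs, ht] <;> ring

theorem contract_tensE {n : ℕ} (σ ρ : SignType) (τ : MIdx n) (p : ℝ × ℝ × ℝ) :
    contract (tensE (Fin.cons σ (Fin.cons ρ τ : MIdx (n + 1)) : MIdx (n + 2)) p)
      = (if σ = -ρ then (1 : ℂ) else 0) • tensE τ p := by
  ext K
  simp only [contract, tensE_cons, Pi.smul_apply, smul_eq_mul, ← sum_spinE_mul_spinE σ ρ p,
    Finset.sum_mul, Fin.cons_zero, Fin.tail_cons, mul_assoc]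

theorem contract_sum {n : ℕ} {ι : Type*} (s : Finset ι) (S : ι → Tensor (n + 2)) :
    contract (∑ i ∈ s, S i) = ∑ i ∈ s, contract (S i) := by
  ext K
  simp only [contract, Finset.sum_apply]
  exact Finset.sum_comm

theorem contract_smul {n : ℕ} (c : ℂ) (S : Tensor (n + 2)) : contract (c • S) = c • contract S := by
  ext K
  simp [contract, Finset.mul_sum]

theorem contract_modeField {n : ℕ} (q : Mode) (C : MIdx (n + 2) → ℝ → ℂ) (p : ℝ × ℝ × ℝ) :
    contract (modeField q C p)
      = ∑ τ : MIdx n, (∑ σ : SignType,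
          modeComp q C (Fin.cons σ (Fin.cons (-σ) τ : MIdx (n + 1))) p) • tensE τ p := by
  rw [modeField_eq]
  simp only [sum_mIdx_succ, contract_sum, contract_smul, contract_tensE]
  rw [Finset.sum_congr rfl fun _ _ => Finset.sum_comm, Finset.sum_comm]
  refine Finset.sum_congr rfl fun τ _ => ?_
  rw [Finset.sum_smul]
  refine Finset.sum_congr rfl fun σ _ => ?_
  rw [Finset.sum_eq_single (-σ)]
  · simp
  · intro ρ _ h
    rw [if_neg, zero_smul, smul_zero]
    rintro rfl
    exact h (neg_neg ρ).symm
  · simp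

/-- Since e(σ)·e(ρ) = δ_{σ,-ρ}, contracting the gradient sums Q over opposite first indices.
`contraction_xi` then leaves only the gradient index `-a` and exchanges the two ξ factors. -/
theorem tdiv_modeField {n : ℕ} (q : Mode) {A : MIdx (n + 1) → ℝ → ℂ} {p : ℝ × ℝ × ℝ}
    (hp : Real.sin p.2.1 ≠ 0) (hA : ∀ a, DifferentiableAt ℝ (A a) p.1) :
    tdiv (modeField q A) p = modeField q (fun (b : MIdx n) r => ∑ a : SignType,
      (xi a ((q.1.1 : ℤ) + wt b) : ℂ)
        * radD (-a) ((q.1.1 : ℤ) + (a : ℤ) + wt b) (A (Fin.cons a b)) r) p := by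
  rw [tdiv, tgrad_modeField q hp hA, contract_modeField, modeField_eq]
  refine Finset.sum_congr rfl fun τ _ => ?_
  congr 1
  simp only [modeComp, sum_mIdx_succ, Fin.cons_zero, Fin.tail_cons, wt_cons]
  simp only [Finset.mul_sum, Finset.sum_mul]
  rw [Finset.sum_comm, Finset.sum_congr rfl fun _ _ => Finset.sum_comm, Finset.sum_comm,
    Finset.sum_congr rfl fun _ _ => Finset.sum_congr rfl fun _ _ => Finset.sum_comm]
  rw [Finset.sum_congr rfl fun _ _ => Finset.sum_comm, Finset.sum_comm]
  refine Finset.sum_congr rfl fun b _ => ?_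
  refine Finset.sum_congr rfl fun a _ => ?_
  have hs : ∀ σ : SignType, (σ : ℤ) + (((-σ : SignType) : ℤ) + wt τ) = wt τ := fun σ => by
    rw [SignType.coe_neg]
    ring
  have key : ∀ c : SignType, ∑ σ : SignType, (qMat q.1.1 (n + 2)
      (Fin.cons σ (Fin.cons (-σ) τ : MIdx (n + 1))) (Fin.cons c (Fin.cons a b : MIdx (n + 1))) : ℂ)
        * ((xi c (q.1.1 + (a + wt b)) : ℂ) * radD c (q.1.1 + (a + wt b)) (A (Fin.cons a b)) p.1)
        * sphY q.1.1 q.1.2 (wt τ) p.2.1 p.2.2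
      = (if c = -a then 1 else 0) * (xi a (q.1.1 + wt b) * qMat q.1.1 n τ b)
        * (radD c (q.1.1 + (a + wt b)) (A (Fin.cons a b)) p.1
          * sphY q.1.1 q.1.2 (wt τ) p.2.1 p.2.2) := by
    intro c
    have h := congrArg Complex.ofReal (contraction_xi (ℓ := q.1.1) c a b τ)
    push_cast at h
    simp only [apply_ite Complex.ofReal, Complex.ofReal_one, Complex.ofReal_zero, add_assoc] at h
    rw [← mul_assoc _ (xi a _ : ℂ), ← h]
    simp only [Finset.mul_sum, Finset.sum_mul]
    exact Finset.sum_congr rfl fun σ _ => by ring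
  simp only [hs, key]
  rw [Finset.sum_eq_single (-a)]
  · rw [if_pos rfl, add_assoc]
    ring
  · intro c _ hc
    rw [if_neg hc]
    ring
  · simp

theorem isOpen_chart : IsOpen chart := by
  have h1 : Continuous fun p : ℝ × ℝ × ℝ => p.1 := continuous_fst
  have h2 : Continuous fun p : ℝ × ℝ × ℝ => p.2.1 := continuous_snd.fst
  exact (isOpen_lt continuous_const h1).inter ((isOpen_lt h1 continuous_const).inter
    ((isOpen_lt continuous_const h2).inter (isOpen_lt h2 continuous_const)))

theorem sin_ne_zero_of_mem_chart {p : ℝ × ℝ × ℝ} (hp : p ∈ chart) : Real.sin p.2.1 ≠ 0 :=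
  (Real.sin_pos_of_pos_of_lt_pi hp.2.2.1 hp.2.2.2).ne'

section radial
variable {f : ℝ → ℂ} {r : ℝ}

theorem differentiableAt_radD (a : SignType) (L : ℤ) (hr : r ≠ 0) (hf : DifferentiableAt ℝ f r)
    (hf' : DifferentiableAt ℝ (deriv f) r) : DifferentiableAt ℝ (radD a L f) r := by
  have h : ∀ c : ℂ, DifferentiableAt ℝ (fun r : ℝ => c / (r : ℂ) * f r) r := fun c =>
    ((differentiableAt_const c).div Complex.ofRealCLM.differentiableAt
      (by simpa using hr)).mul hf
  cases a
  · exact differentiableAt_const _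
  · exact hf'.add (h _)
  · exact hf'.sub (h _)

theorem radD_const_mul (a : SignType) (L : ℤ) (c : ℂ) :
    radD a L (fun r => c * f r) r = c * radD a L f r := by
  cases a
  · simp [radD]
  · simp [radD]
    ring
  · simp [radD]
    ring

theorem hasDerivAt_div_mul (c : ℂ) (hr : r ≠ 0) (hf : DifferentiableAt ℝ f r) :
    HasDerivAt (fun r : ℝ => c / (r : ℂ) * f r) (c / r * deriv f r - c / r ^ 2 * f r) r := by
  have hr' : (r : ℂ) ≠ 0 := by exact_mod_cast hr
  have h1 : HasDerivAt (fun r : ℝ => c / (r : ℂ)) ((0 * (r : ℂ) - c * 1) / (r : ℂ) ^ 2) r :=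
    (hasDerivAt_const r c).div (Complex.ofRealCLM.hasDerivAt (x := r)) hr'
  refine (h1.mul hf.hasDerivAt).congr_deriv ?_
  ring

theorem radD_neg_radD_pos (L : ℤ) (hr : r ≠ 0) (hf : DifferentiableAt ℝ f r)
    (hf' : DifferentiableAt ℝ (deriv f) r) :
    radD (-1) (L + 1) (radD 1 L f) r
      = deriv (deriv f) r + 2 / r * deriv f r - L * (L + 1) / r ^ 2 * f r := by
  have hr' : (r : ℂ) ≠ 0 := by exact_mod_cast hr
  have h := hf'.hasDerivAt.fun_sub (hasDerivAt_div_mul (L : ℂ) hr hf)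
  change deriv (fun r => deriv f r - (L : ℂ) / (r : ℂ) * f r) r
    + (((L + 1 : ℤ) : ℂ) + 1) / r * (deriv f r - (L : ℂ) / (r : ℂ) * f r) = _
  rw [HasDerivAt.deriv h]
  push_cast
  field_simp
  ring

theorem radD_pos_radD_neg (L : ℤ) (hr : r ≠ 0) (hf : DifferentiableAt ℝ f r)
    (hf' : DifferentiableAt ℝ (deriv f) r) :
    radD 1 (L - 1) (radD (-1) L f) r
      = deriv (deriv f) r + 2 / r * deriv f r - L * (L + 1) / r ^ 2 * f r := by
  have hr' : (r : ℂ) ≠ 0 := by exact_mod_cast hr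
  have h := hf'.hasDerivAt.fun_add (hasDerivAt_div_mul ((L : ℂ) + 1) hr hf)
  change deriv (fun r => deriv f r + ((L : ℂ) + 1) / (r : ℂ) * f r) r
    - ((L - 1 : ℤ) : ℂ) / r * (deriv f r + ((L : ℂ) + 1) / (r : ℂ) * f r) = _
  rw [HasDerivAt.deriv h]
  push_cast
  field_simp
  ring

/-- Both signs give the same second-order operator, and the squares of ξ^± sum to 1. -/
theorem sum_xi_mul_radD_radD (L : ℤ) (hr : r ≠ 0) (hf : DifferentiableAt ℝ f r)
    (hf' : DifferentiableAt ℝ (deriv f) r) :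
    ∑ a : SignType, (xi a L : ℂ) * radD (-a) (L + a) (fun r => (xi a L : ℂ) * radD a L f r) r
      = radD (-1) (L + 1) (radD 1 L f) r := by
  have h1 : xi 1 L ^ 2 + xi (-1) L ^ 2 = 1 := by
    change √(((L : ℝ) + 1) / (2 * L + 1)) ^ 2 + √((L : ℝ) / (2 * L + 1)) ^ 2 = 1
    have h2 : (2 * (L : ℝ) + 1) ≠ 0 := by exact_mod_cast (by omega : 2 * L + 1 ≠ 0)
    have h3 : 0 ≤ ((L : ℝ) + 1) / (2 * L + 1) ∧ 0 ≤ (L : ℝ) / (2 * L + 1) := by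
      -- Negative L is included so that non-admissible indices need no separate treatment;
      -- numerators and denominator are then nonpositive.
      rcases le_or_gt 0 L with h | h
      · have h' : (0 : ℝ) ≤ L := by exact_mod_cast h
        constructor <;> positivity
      · have h' : (L : ℝ) ≤ -1 := by exact_mod_cast (by omega : L ≤ -1)
        exact ⟨div_nonneg_of_nonpos (by linarith) (by linarith),
          div_nonneg_of_nonpos (by linarith) (by linarith)⟩
    rw [Real.sq_sqrt h3.1, Real.sq_sqrt h3.2]
    rw [← add_div, div_eq_one_iff_eq h2]
    ring
  have h1 := congrArg Complex.ofReal h1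
  push_cast at h1
  rw [sum_signType]
  simp only [radD_const_mul, neg_neg, neg_zero, SignType.coe_neg, SignType.coe_one,
    ← sub_eq_add_neg L]
  have h0 : (xi 0 L : ℂ) = 0 := by simp [show xi 0 L = 0 from rfl]
  rw [h0, radD_pos_radD_neg L hr hf hf', radD_neg_radD_pos L hr hf hf']
  linear_combination (deriv (deriv f) r + 2 / r * deriv f r - L * (L + 1) / r ^ 2 * f r) * h1

end radial

theorem tdiv_congr {n : ℕ} {S T : ℝ × ℝ × ℝ → Tensor (n + 1)} {p : ℝ × ℝ × ℝ}
    (h : S =ᶠ[nhds p] T) : tdiv S p = tdiv T p := by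
  have h' : tgrad S p = tgrad T p := by
    ext K
    simp only [tgrad, h.fderiv_eq]
  rw [tdiv, tdiv, h']

theorem tlap_modeField {n : ℕ} (q : Mode) {A : MIdx n → ℝ → ℂ}
    (hA : ∀ a, DifferentiableOn ℝ (A a) (Set.Ioo 0 1))
    (hA' : ∀ a, DifferentiableOn ℝ (deriv (A a)) (Set.Ioo 0 1)) {p : ℝ × ℝ × ℝ} (hp : p ∈ chart) :
    tlap (modeField q A) p = modeField q (fun a => radD (-1) ((q.1.1 : ℤ) + wt a + 1)
      (radD 1 ((q.1.1 : ℤ) + wt a) (A a))) p := by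
  have hd : ∀ {p}, p ∈ chart → ∀ a, DifferentiableAt ℝ (A a) p.1 := fun hp a =>
    (hA a).differentiableAt (Ioo_mem_nhds hp.1 hp.2.1)
  have hd' : ∀ {p}, p ∈ chart → ∀ a, DifferentiableAt ℝ (deriv (A a)) p.1 := fun hp a =>
    (hA' a).differentiableAt (Ioo_mem_nhds hp.1 hp.2.1)
  have h : tgrad (modeField q A) =ᶠ[nhds p] modeField q (fun (c : MIdx (n + 1)) r =>
      (xi (c 0) (q.1.1 + wt (Fin.tail c)) : ℂ) * radD (c 0) (q.1.1 + wt (Fin.tail c))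
        (A (Fin.tail c)) r) := by
    filter_upwards [isOpen_chart.mem_nhds hp] with p hp
    exact tgrad_modeField q (sin_ne_zero_of_mem_chart hp) (hd hp)
  rw [tlap, tdiv_congr h, tdiv_modeField q (sin_ne_zero_of_mem_chart hp) fun c =>
    (differentiableAt_radD _ _ hp.1.ne' (hd hp _) (hd' hp _)).const_mul _]
  simp only [modeField, Fin.cons_zero, Fin.tail_cons, add_right_comm _ _ (wt _)]
  simp only [sum_xi_mul_radD_radD _ hp.1.ne' (hd hp _) (hd' hp _)]

end BallTensor
end

/-! ### Termwise differentiation of the series. -/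

open scoped BigOperators
noncomputable section
namespace BallTensor

section series
variable {ι E V : Type*} [NormedAddCommGroup E] [NormedSpace ℝ E] [NormedAddCommGroup V]
  [NormedSpace ℝ V]

theorem hasSum_fderiv_of_summableLocallyUniformlyOn {s : Set E} (hs : IsOpen s) {f : ι → E → V}
    {F : E → V} (hf : ∀ i, ∀ x ∈ s, DifferentiableAt ℝ (f i) x)
    (hF : ∀ x ∈ s, HasSum (fun i => f i x) (F x))
    (hf' : SummableLocallyUniformlyOn (fun i => fderiv ℝ (f i)) s) {x : E} (hx : x ∈ s) :
    DifferentiableAt ℝ F x ∧ HasSum (fun i => fderiv ℝ (f i) x) (fderiv ℝ F x) := by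
  obtain ⟨g, hg⟩ := hf'
  have h : HasFDerivAt F (g x) x :=
    hasFDerivAt_of_tendstoLocallyUniformlyOn hs hg
      (fun S y hy => HasFDerivAt.fun_sum fun i _ => (hf i y hy).hasFDerivAt) hF hx
  exact ⟨h.differentiableAt, h.fderiv ▸ hg.hasSum hx⟩

end series

theorem HasSum.clm_tensor_apply {n : ℕ} {ι : Type*} {f : ι → (ℝ × ℝ × ℝ) →L[ℝ] Tensor n}
    {g : (ℝ × ℝ × ℝ) →L[ℝ] Tensor n} (h : HasSum f g) (v : ℝ × ℝ × ℝ) (K : Fin n → Fin 3) :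
    HasSum (fun i => f i v K) (g v K) :=
  Pi.hasSum.1 ((ContinuousLinearMap.apply ℝ (Tensor n) v).hasSum h) K

theorem hasSum_tgrad {n : ℕ} {ι : Type*} {f : ι → ℝ × ℝ × ℝ → Tensor n}
    {T : ℝ × ℝ × ℝ → Tensor n} {p : ℝ × ℝ × ℝ}
    (h : ∀ v K, HasSum (fun i => fderiv ℝ (f i) p v K) (fderiv ℝ T p v K)) :
    HasSum (fun i => tgrad (f i) p) (tgrad T p) :=
  Pi.hasSum.2 fun _ => (((h _ _).mul_left _).add (((h _ _).mul_left _).mul_left _)).add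
    (((h _ _).mul_left _).mul_left _)

theorem HasSum.contract {n : ℕ} {ι : Type*} {f : ι → Tensor (n + 2)} {S : Tensor (n + 2)}
    (h : HasSum f S) : HasSum (fun i => contract (f i)) (contract S) :=
  Pi.hasSum.2 fun _ => hasSum_sum fun _ _ => Pi.hasSum.1 h _

theorem differentiableAt_modeField {n : ℕ} (q : Mode) {A : MIdx n → ℝ → ℂ} {p : ℝ × ℝ × ℝ}
    (hA : ∀ a, DifferentiableAt ℝ (A a) p.1) : DifferentiableAt ℝ (modeField q A) p := by
  rw [modeField_eq]
  exact differentiableAt_sum_smul_tensE (differentiableAt_modeComp q hA)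

end BallTensor
end

/-! ### Second derivatives and the Laplacian of the series. -/

open scoped BigOperators
noncomputable section
namespace BallTensor

theorem hasFDerivAt_radial_smul {V : Type*} [NormedAddCommGroup V] [NormedSpace ℂ V]
    {f : ℝ → ℂ} {G : ℝ × ℝ × ℝ → V} {p : ℝ × ℝ × ℝ}
    (hf : DifferentiableAt ℝ f p.1) (hG : DifferentiableAt ℝ G p) :
    HasFDerivAt (fun x : ℝ × ℝ × ℝ => f x.1 • G x) (f p.1 • fderiv ℝ G p
      + ContinuousLinearMap.smulRightL ℝ (ℝ × ℝ × ℝ) V (ContinuousLinearMap.fst ℝ ℝ (ℝ × ℝ))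
        (deriv f p.1 • G p)) p := by
  have h1 := hf.hasDerivAt.hasFDerivAt.comp p (hasFDerivAt_fst (𝕜 := ℝ) (p := p))
  refine (h1.fun_smul hG.hasFDerivAt).congr_fderiv ?_
  ext <;> simp

/-- The radial functions are twice differentiable but perhaps not C². The product formula for the
first derivative holds on a neighbourhood, and each of its factors is differentiable at `p`. -/
theorem differentiableAt_fderiv_radial_smul {V ι : Type*} [NormedAddCommGroup V] [NormedSpace ℂ V]
    [Fintype ι] {f : ι → ℝ → ℂ} {G : ι → ℝ × ℝ × ℝ → V} {p : ℝ × ℝ × ℝ}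
    (hf : ∀ i, ∀ᶠ x in nhds p, DifferentiableAt ℝ (f i) x.1)
    (hf' : ∀ i, DifferentiableAt ℝ (deriv (f i)) p.1) (hG : ∀ i, ContDiff ℝ 2 (G i)) :
    DifferentiableAt ℝ (fderiv ℝ fun x : ℝ × ℝ × ℝ => ∑ i, f i x.1 • G i x) p := by
  have hG1 := fun i => (hG i).differentiable two_ne_zero
  have hG2 := fun i => ((hG i).fderiv_right (m := 1) (by norm_num)).differentiable one_ne_zero
  have he : fderiv ℝ (fun x : ℝ × ℝ × ℝ => ∑ i, f i x.1 • G i x) =ᶠ[nhds p] fun x =>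
      ∑ i, (f i x.1 • fderiv ℝ (G i) x
        + ContinuousLinearMap.smulRightL ℝ (ℝ × ℝ × ℝ) V (ContinuousLinearMap.fst ℝ ℝ (ℝ × ℝ))
          (deriv (f i) x.1 • G i x)) := by
    filter_upwards [Filter.eventually_all.2 hf] with x hx
    exact (HasFDerivAt.fun_sum fun i _ => hasFDerivAt_radial_smul (hx i) (hG1 i x)).fderiv
  refine DifferentiableAt.congr_of_eventuallyEq (DifferentiableAt.fun_sum fun i _ => ?_) he
  refine DifferentiableAt.add ?_ ?_
  · exact DifferentiableAt.smul ((hf i).self_of_nhds.comp p differentiableAt_fst) (hG2 i p)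
  · exact (ContinuousLinearMap.differentiableAt _).comp p
      (DifferentiableAt.smul ((hf' i).comp p differentiableAt_fst) (hG1 i p))

theorem differentiableAt_fderiv_modeField {n : ℕ} (q : Mode) {A : MIdx n → ℝ → ℂ} {p : ℝ × ℝ × ℝ}
    (hp : p ∈ chart) (hA : ∀ a, ∀ r ∈ Set.Ioo (0 : ℝ) 1, DifferentiableAt ℝ (A a) r)
    (hA' : ∀ a, ∀ r ∈ Set.Ioo (0 : ℝ) 1, DifferentiableAt ℝ (deriv (A a)) r) :
    DifferentiableAt ℝ (fderiv ℝ (modeField q A)) p := by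
  have h : modeField q A = fun x => ∑ a, A a x.1 • ∑ σ,
      ((qMat q.1.1 n σ a : ℂ) * sphY q.1.1 q.1.2 (wt σ) x.2.1 x.2.2) • tensE σ x := by
    ext1 x
    simp only [modeField, Finset.smul_sum, smul_smul]
    exact Finset.sum_congr rfl fun a _ => Finset.sum_congr rfl fun σ _ => by congr 1; ring
  rw [h]
  refine differentiableAt_fderiv_radial_smul (fun a => ?_) (fun a => hA' a _ ⟨hp.1, hp.2.1⟩)
    fun a => ContDiff.sum fun σ _ => (contDiff_const.mul (contDiff_sphY _ _ _)).smul
      (contDiff_tensE σ)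
  filter_upwards [isOpen_chart.mem_nhds hp] with x hx using hA a _ ⟨hx.1, hx.2.1⟩

section secondDerivatives
variable {n : ℕ} {p : ℝ × ℝ × ℝ}

/-- The coefficients of the partial derivatives in the Cartesian components of the gradient. -/
def gradCoef (p : ℝ × ℝ × ℝ) (i : Fin 3) : Fin 3 → ℂ :=
  ![eR p i, eTheta p i * (p.1 : ℂ)⁻¹, ePhi p i * ((p.1 * Real.sin p.2.1 : ℝ) : ℂ)⁻¹]

/-- The coordinate directions of `(r, θ, φ)`. -/
def coordDir : Fin 3 → ℝ × ℝ × ℝ :=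
  ![(1, 0, 0), (0, 1, 0), (0, 0, 1)]

theorem tgrad_apply_eq_sum (F : ℝ × ℝ × ℝ → Tensor n) (p : ℝ × ℝ × ℝ) (K : Fin (n + 1) → Fin 3) :
    tgrad F p K = ∑ j, gradCoef p (K 0) j * fderiv ℝ F p (coordDir j) (Fin.tail K) := by
  simp [tgrad, gradCoef, coordDir, Fin.sum_univ_three, mul_assoc]

theorem differentiableAt_gradCoef (hp : p ∈ chart) (i j : Fin 3) :
    DifferentiableAt ℝ (fun x => gradCoef x i j) p := by
  have h1 : (p.1 : ℂ) ≠ 0 := by exact_mod_cast hp.1.ne'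
  have h2 : ((p.1 * Real.sin p.2.1 : ℝ) : ℂ) ≠ 0 := by
    exact_mod_cast mul_ne_zero hp.1.ne' (sin_ne_zero_of_mem_chart hp)
  have hc : ∀ f : ℝ × ℝ × ℝ → ℝ, ContDiff ℝ 1 f → DifferentiableAt ℝ (fun x => (f x : ℂ)) p :=
    fun f hf => (contDiff_ofReal_comp hf).differentiable one_ne_zero p
  fin_cases j
  · exact (contDiff_eR i (n := 1)).differentiable one_ne_zero p
  · exact ((contDiff_eTheta i (n := 1)).differentiable one_ne_zero p).fun_mul
      ((hc _ contDiff_fst).fun_inv h1)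
  · exact ((contDiff_ePhi i (n := 1)).differentiable one_ne_zero p).fun_mul
      ((hc (fun x => x.1 * Real.sin x.2.1) (by fun_prop)).fun_inv h2)

theorem hasFDerivAt_tgrad_apply {F : ℝ × ℝ × ℝ → Tensor n} (hp : p ∈ chart)
    (hF : DifferentiableAt ℝ (fderiv ℝ F) p) (K : Fin (n + 1) → Fin 3) :
    DifferentiableAt ℝ (fun x => tgrad F x K) p ∧ ∀ v, fderiv ℝ (fun x => tgrad F x K) p v
      = ∑ j, (gradCoef p (K 0) j * fderiv ℝ (fderiv ℝ F) p v (coordDir j) (Fin.tail K)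
        + fderiv ℝ F p (coordDir j) (Fin.tail K) * fderiv ℝ (fun x => gradCoef x (K 0) j) p v) := by
  have h1 : ∀ j, HasFDerivAt (fun x => fderiv ℝ F x (coordDir j) (Fin.tail K))
      ((ContinuousLinearMap.proj (R := ℝ) (φ := fun _ : Fin n → Fin 3 => ℂ) (Fin.tail K)).comp
        ((ContinuousLinearMap.apply ℝ (Tensor n) (coordDir j)).comp (fderiv ℝ (fderiv ℝ F) p))) p :=
    fun j => (((ContinuousLinearMap.proj (R := ℝ) (φ := fun _ : Fin n → Fin 3 => ℂ)
      (Fin.tail K)).comp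
        (ContinuousLinearMap.apply ℝ (Tensor n) (coordDir j))).hasFDerivAt).comp p hF.hasFDerivAt
  have h := HasFDerivAt.fun_sum (u := Finset.univ) fun j _ =>
    (differentiableAt_gradCoef hp (K 0) j).hasFDerivAt.fun_mul (h1 j)
  simp only [← tgrad_apply_eq_sum] at h
  refine ⟨h.differentiableAt, fun v => ?_⟩
  rw [h.fderiv]
  simp

theorem differentiableAt_tgrad {F : ℝ × ℝ × ℝ → Tensor n} (hp : p ∈ chart)
    (hF : DifferentiableAt ℝ (fderiv ℝ F) p) : DifferentiableAt ℝ (tgrad F) p :=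
  differentiableAt_pi.2 fun K => (hasFDerivAt_tgrad_apply hp hF K).1

/-- At a fixed point the Laplacian is a linear function of the first and second derivatives, as
`hasFDerivAt_tgrad_apply` shows, so it commutes with the sum. -/
theorem hasSum_tlap {ι : Type*} {f : ι → ℝ × ℝ × ℝ → Tensor n} {T : ℝ × ℝ × ℝ → Tensor n}
    (hp : p ∈ chart) (hf : ∀ i, DifferentiableAt ℝ (fderiv ℝ (f i)) p)
    (hT : DifferentiableAt ℝ (fderiv ℝ T) p)
    (h1 : HasSum (fun i => fderiv ℝ (f i) p) (fderiv ℝ T p))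
    (h2 : HasSum (fun i => fderiv ℝ (fderiv ℝ (f i)) p) (fderiv ℝ (fderiv ℝ T) p)) :
    HasSum (fun i => tlap (f i) p) (tlap T p) := by
  refine HasSum.contract (hasSum_tgrad fun v K => ?_)
  simp only [fderiv_apply_tensor (differentiableAt_tgrad hp (hf _)),
    fderiv_apply_tensor (differentiableAt_tgrad hp hT), (hasFDerivAt_tgrad_apply hp (hf _) K).2,
    (hasFDerivAt_tgrad_apply hp hT K).2]
  have h3 : HasSum (fun i => fderiv ℝ (fderiv ℝ (f i)) p v) (fderiv ℝ (fderiv ℝ T) p v) :=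
    (ContinuousLinearMap.apply ℝ ((ℝ × ℝ × ℝ) →L[ℝ] Tensor n) v).hasSum h2
  exact hasSum_sum fun j _ => ((HasSum.clm_tensor_apply h3 _ _).mul_left _).add
    ((HasSum.clm_tensor_apply h1 _ _).mul_right _)

end secondDerivatives

end BallTensor
end

/-! ### Assembly of the theorem. -/

open BallTensor

theorem mainTheorem7 :
    -- contraction of the first two indices of `Q_ℓ`, in every rank
    (∀ (n ℓ : ℕ) (a b : SignType) (c κ : BallTensor.MIdx n),
      BallTensor.Admissible ℓ (Fin.cons a (Fin.cons b c : BallTensor.MIdx (n + 1)) :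
        BallTensor.MIdx (n + 2)) →
      (∑ σ : SignType, ∑ τ : SignType, (if σ = -τ then (1 : ℝ) else 0)
          * BallTensor.qMat ℓ (n + 2) (Fin.cons σ (Fin.cons τ κ : BallTensor.MIdx (n + 1)))
              (Fin.cons a (Fin.cons b c : BallTensor.MIdx (n + 1)))
        = (if a = -b then (1 : ℝ) else 0)
          * √((2 * ((ℓ : ℝ) + (b : ℝ) + (BallTensor.wt c : ℝ)) + 1)
              / (2 * ((ℓ : ℝ) + (BallTensor.wt c : ℝ)) + 1))
          * BallTensor.qMat ℓ n κ c)
      ∧ (∑ σ : SignType, ∑ τ : SignType, (if σ = -τ then (1 : ℝ) else 0)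
          * BallTensor.xi a ((ℓ : ℤ) + (b : ℤ) + BallTensor.wt c)
          * BallTensor.qMat ℓ (n + 2) (Fin.cons σ (Fin.cons τ κ : BallTensor.MIdx (n + 1)))
              (Fin.cons a (Fin.cons b c : BallTensor.MIdx (n + 1)))
        = (if a = -b then (1 : ℝ) else 0)
          * BallTensor.xi b ((ℓ : ℤ) + BallTensor.wt c)
          * BallTensor.qMat ℓ n κ c))
    ∧
    -- divergence of a tensor field of rank `n + 1`
    (∀ (n : ℕ) (A : BallTensor.Mode → BallTensor.MIdx (n + 1) → ℝ → ℂ)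
      (T : ℝ × ℝ × ℝ → BallTensor.Tensor (n + 1)),
      (∀ q a, DifferentiableOn ℝ (A q a) (Set.Ioo 0 1)) →
      (∀ p ∈ BallTensor.chart, HasSum (fun q => BallTensor.modeField q (A q) p) (T p)) →
      SummableLocallyUniformlyOn
        (fun q => fderiv ℝ (BallTensor.modeField q (A q))) BallTensor.chart →
      ∀ p ∈ BallTensor.chart, DifferentiableAt ℝ T p ∧
        HasSum (fun q : BallTensor.Mode => BallTensor.modeField q
            (fun (b : BallTensor.MIdx n) (r : ℝ) => ∑ a : SignType,
              (BallTensor.xi a ((q.1.1 : ℤ) + BallTensor.wt b) : ℂ)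
                * BallTensor.radD (-a) ((q.1.1 : ℤ) + (a : ℤ) + BallTensor.wt b)
                    (A q (Fin.cons a b)) r) p)
          (BallTensor.tdiv T p))
    ∧
    -- Laplacian of a tensor field of rank `n`
    (∀ (n : ℕ) (A : BallTensor.Mode → BallTensor.MIdx n → ℝ → ℂ)
      (T : ℝ × ℝ × ℝ → BallTensor.Tensor n),
      (∀ q a, DifferentiableOn ℝ (A q a) (Set.Ioo 0 1)) →
      (∀ q a, DifferentiableOn ℝ (deriv (A q a)) (Set.Ioo 0 1)) →
      (∀ p ∈ BallTensor.chart, HasSum (fun q => BallTensor.modeField q (A q) p) (T p)) →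
      SummableLocallyUniformlyOn
        (fun q => fderiv ℝ (BallTensor.modeField q (A q))) BallTensor.chart →
      SummableLocallyUniformlyOn
        (fun q => fderiv ℝ (fderiv ℝ (BallTensor.modeField q (A q)))) BallTensor.chart →
      (∀ p ∈ BallTensor.chart, DifferentiableAt ℝ T p ∧ DifferentiableAt ℝ (fderiv ℝ T) p ∧
        HasSum (fun q : BallTensor.Mode => BallTensor.modeField q
            (fun (a : BallTensor.MIdx n) =>
              BallTensor.radD (-1) ((q.1.1 : ℤ) + BallTensor.wt a + 1)
                (BallTensor.radD 1 ((q.1.1 : ℤ) + BallTensor.wt a) (A q a))) p)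
          (BallTensor.tlap T p))
      ∧ ∀ (q : BallTensor.Mode) (a : BallTensor.MIdx n), ∀ r ∈ Set.Ioo (0 : ℝ) 1,
          BallTensor.radD (-1) ((q.1.1 : ℤ) + BallTensor.wt a + 1)
              (BallTensor.radD 1 ((q.1.1 : ℤ) + BallTensor.wt a) (A q a)) r
            = BallTensor.radD 1 ((q.1.1 : ℤ) + BallTensor.wt a - 1)
              (BallTensor.radD (-1) ((q.1.1 : ℤ) + BallTensor.wt a) (A q a)) r) := by
  refine ⟨fun n ℓ a b c κ h => ⟨?_, ?_⟩, fun n A T hA hT hT' p hp => ?_,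
    fun n A T hA hA' hT hT' hT'' => ⟨fun p hp => ?_, fun q a r hr => ?_⟩⟩
  · rw [sum_signType_ite fun σ τ => qMat ℓ (n + 2) (Fin.cons σ (Fin.cons τ κ : MIdx (n + 1)))
      (Fin.cons a (Fin.cons b c : MIdx (n + 1)))]
    exact contraction a b c κ (by simpa using h.1)
  · rw [← contraction_xi a b c κ, Finset.mul_sum]
    simp only [mul_assoc]
    exact sum_signType_ite fun σ τ => xi a ((ℓ : ℤ) + b + wt c)
      * qMat ℓ (n + 2) (Fin.cons σ (Fin.cons τ κ : MIdx (n + 1)))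
        (Fin.cons a (Fin.cons b c : MIdx (n + 1)))
  · have hd : ∀ q, ∀ x ∈ chart, ∀ a, DifferentiableAt ℝ (A q a) x.1 := fun q x hx a =>
      (hA q a).differentiableAt (Ioo_mem_nhds hx.1 hx.2.1)
    obtain ⟨h1, h2⟩ := hasSum_fderiv_of_summableLocallyUniformlyOn isOpen_chart
      (fun q x hx => differentiableAt_modeField q (hd q x hx)) hT hT' hp
    refine ⟨h1, ?_⟩
    simp only [← tdiv_modeField _ (sin_ne_zero_of_mem_chart hp) (hd _ p hp)]
    exact (hasSum_tgrad fun v K => h2.clm_tensor_apply v K).contract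
  · have hd : ∀ q a, ∀ r ∈ Set.Ioo (0 : ℝ) 1, DifferentiableAt ℝ (A q a) r := fun q a r hr =>
      (hA q a).differentiableAt (Ioo_mem_nhds hr.1 hr.2)
    have hd' : ∀ q a, ∀ r ∈ Set.Ioo (0 : ℝ) 1, DifferentiableAt ℝ (deriv (A q a)) r :=
      fun q a r hr => (hA' q a).differentiableAt (Ioo_mem_nhds hr.1 hr.2)
    have h1 := fun x hx => hasSum_fderiv_of_summableLocallyUniformlyOn isOpen_chart
      (fun q x hx => differentiableAt_modeField q fun a => hd q a _ ⟨hx.1, hx.2.1⟩) hT hT'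
        (x := x) hx
    have h2 := fun q x hx => differentiableAt_fderiv_modeField q (p := x) hx (hd q) (hd' q)
    -- Termwise differentiation is applied a second time, now to the series of first derivatives,
    -- whose sum `h1` identifies on the whole chart.
    obtain ⟨h3, h4⟩ := hasSum_fderiv_of_summableLocallyUniformlyOn isOpen_chart h2
      (fun x hx => (h1 x hx).2) hT'' hp
    refine ⟨(h1 p hp).1, h3, ?_⟩
    simp only [← tlap_modeField _ (hA _) (hA' _) hp]
    exact hasSum_tlap hp (fun q => h2 q p hp) h3 (h1 p hp).2 h4
  · have h1 := (hA q a).differentiableAt (Ioo_mem_nhds hr.1 hr.2)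
    have h2 := (hA' q a).differentiableAt (Ioo_mem_nhds hr.1 hr.2)
    rw [radD_neg_radD_pos _ hr.1.ne' h1 h2, radD_pos_radD_neg _ hr.1.ne' h1 h2]
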